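/- **Conventions.** A *braided Gr-category* $\mathbb B$ is a braided monoidal category in which every morphism is an isomorphism and every object is invertible for $\otimes$. A *braided Gr-functor* is a (strong) monoidal functor $(F,\widetilde F,F_*)$ compatible with the braidings; $\mathcal{BCG}$ is the category of braided Gr-categories and braided Gr-functors. Two braided Gr-functors are *homotopic* if there is a monoidal natural isomorphism between them, and a braided Gr-functor is an *equivalence* if it has an inverse braided Gr-functor up to homotopy. Let $\pi_0\mathbb B$ be the abelian group of isomorphism classes of objects with $[X]+[Y]=[X\otimes Y]$, and $\pi_1\mathbb B$ the abelian group of automorphisms of the unit object $I$ under composition. A braided Gr-functor $F$ induces homomorphisms $F_0[X]=[FX]$ and $F_1(u)=F_*^{-1}\circ F(u)\circ F_*$. For $u\in\pi_1\mathbb B$ let $\gamma_X(u)$ be the automorphism of $X\cong I\otimes X$ given by $u\otimes \mathrm{id}_X$. For abelian groups $M,N$, an *abelian 3-cocycle* is a pair of functions $h:M^3\to N$, $\eta:M^2\to N$ with $h(x,y,z)=0$ if one of $x,y,z$ is $0$, and $$h(y,z,t)-h(x+y,z,t)+h(x,y+z,t)-h(x,y,z+t)+h(x,y,z)=0,$$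 $$h(x,y,z)-h(y,x,z)+h(y,z,x)+\eta(x,y+z)-\eta(x,y)-\eta(x,z)=0,$$ $$h(x,y,z)-h(x,z,y)+h(z,x,y)-\eta(x+y,z)+\eta(y,z)+\eta(x,z)=0.$$ For $g:M^2\to N$ with $g(x,0)=g(0,y)=0$ put $\partial_{ab}(g)=(h,\eta)$, where $h(x,y,z)=g(y,z)-g(x+y,z)+g(x,y+z)-g(x,y)$ and $\eta(x,y)=g(y,x)-g(x,y)$. Then $H^3_{ab}(M,N)$ is the group of abelian 3-cocycles modulo the $\partial_{ab}(g)$, and $H^2_{ab}(M,N)$ is the group of normalized $g:M^2\to N$ with $\partial_{ab}(g)=0$ (the symmetric normalized 2-cocycles) modulo the functions $(x,y)\mapsto t(y)-t(x+y)+t(x)$ with $t:M\to N$, $t(0)=0$. Choose representatives $X_s\in s$ for $s\in\pi_0\mathbb B$ with $X_0=I$ (or identified with $I$ by a chosen isomorphism), and isomorphisms $i_{s,t}:X_s\otimes X_t\to X_{s+t}$ that are the unit constraints when $s=0$ or $t=0$. Define $h(s,t,r),\eta(s,t)\in\pi_1\mathbb B$ by $$\gamma(h(s,t,r))\circ i_{s+t,r}\circ(i_{s,t}\otimes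 \mathrm{id})=i_{s,t+r}\circ(\mathrm{id}\otimes i_{t,r})\circ a,\qquad \gamma(\eta(s,t))\circ i_{s,t}=i_{t,s}\circ c,$$ where $a:(X_s\otimes X_t)\otimes X_r\to X_s\otimes(X_t\otimes X_r)$ is the associativity constraint and $c:X_s\otimes X_t\to X_t\otimes X_s$ the braiding. Let $\mathbf H^3_{BGr}$ be the category with objects $(M,N,[(h,\eta)])$, where $M,N$ are abelian groups and $[(h,\eta)]\in H^3_{ab}(M,N)$, and morphisms $(M,N,[(h,\eta)])\to(M',N',[(h',\eta')])$ the pairs of homomorphisms $\varphi:M\to M'$, $f:N\to N'$ with $\varphi^*[(h',\eta')]=f_*[(h,\eta)]$ in $H^3_{ab}(M,N')$. **Theorem 4.3 (The Classification Theorem, braided case).** For every braided Gr-category $\mathbb B$ such choices exist, the pair $(h,\eta)$ is always an abelian 3-cocycle, and its class $[(h,\eta)_{\mathbb B}]\in H^3_{ab}(\pi_0\mathbb B,\pi_1\mathbb B)$ does not depend on the choices. There is a functor $$d:\mathcal{BCG}\to\mathbf H^3_{BGr},\qquad \mathbb B\mapsto(\pi_0\mathbb B,\pi_1\mathbb B,[(h,\eta)_{\mathbb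 B}]),\qquad F\mapsto(F_0,F_1),$$ with the following properties: i) $dF$ is an isomorphism if and only if $F$ is an equivalence, and also if and only if the underlying functor of $F$ is an equivalence of categories; ii) $d$ is surjective on objects up to isomorphism: every object of $\mathbf H^3_{BGr}$ is isomorphic to some $d\mathbb B$; iii) $d$ is full, but not faithful. For every morphism $(\varphi,f):d\mathbb B\to d\mathbb B'$ there is a bijection $$\mathrm{Hom}^{Br}_{(\varphi,f)}[\mathbb B,\mathbb B']\cong H^2_{ab}(\pi_0\mathbb B,\pi_1\mathbb B')$$ from the set of homotopy classes of braided Gr-functors $\mathbb B\to\mathbb B'$ which induce the pair $(\varphi,f)$. -/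

import Mathlib

open CategoryTheory MonoidalCategory

universe v u

namespace BrGr

/-! ### Abelian cohomology of an abelian group `M` with coefficients in an abelian group `N` -/

section Cohomology

variable (M : Type u) (N : Type v) [AddCommGroup M] [AddCommGroup N]

/-- Normalized 1-cochains: functions `t : M → N` with `t 0 = 0`. -/
def C1 : AddSubgroup (M → N) where
  carrier := {t | t 0 = 0}
  zero_mem' := rfl
  add_mem' {a b} ha hb := by
    change a 0 + b 0 = 0
    rw [show a 0 = 0 from ha, show b 0 = 0 from hb, add_zero]
  neg_mem' {a} ha := by
    change - a 0 = 0
    rw [show a 0 = 0 from ha, neg_zero]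

/-- Normalized 2-cochains: functions `g : M² → N` with `g (x, 0) = 0 = g (0, y)`. -/
def C2 : AddSubgroup (M → M → N) where
  carrier := {g | (∀ x, g x 0 = 0) ∧ ∀ y, g 0 y = 0}
  zero_mem' := ⟨fun _ => rfl, fun _ => rfl⟩
  add_mem' {a b} ha hb :=
    ⟨fun x => by simp [ha.1 x, hb.1 x], fun x => by simp [ha.2 x, hb.2 x]⟩
  neg_mem' {a} ha := ⟨fun x => by simp [ha.1 x], fun x => by simp [ha.2 x]⟩

/-- Pairs `(h, η)` of functions `h : M³ → N` and `η : M² → N`. -/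
abbrev C3 := (M → M → M → N) × (M → M → N)

/-- The abelian coboundary of a function of one variable:
`(∂ t)(x, y) = t y - t (x + y) + t x`. -/
def d1 : (M → N) →+ (M → M → N) where
  toFun t x y := t y - t (x + y) + t x
  map_zero' := by funext x y; simp
  map_add' a b := by funext x y; simp only [Pi.add_apply]; abel

/-- The abelian coboundary `∂_ab g = (h, η)` of a function of two variables:
`h (x, y, z) = g (y, z) - g (x + y, z) + g (x, y + z) - g (x, y)` and
`η (x, y) = g (y, x) - g (x, y)`. -/
def d2 : (M → M → N) →+ C3 M N where
  toFun g :=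
    (fun x y z => g y z - g (x + y) z + g x (y + z) - g x y, fun x y => g y x - g x y)
  map_zero' := by ext <;> simp
  map_add' a b := by
    ext <;> simp only [Pi.add_apply, Prod.fst_add, Prod.snd_add] <;> abel

variable {M N}

/-- `(h, η)` is an abelian 3-cocycle: `h` is a normalized 3-cocycle, and `(h, η)` satisfies the
two conditions which correspond to the hexagons. -/
structure IsAbelianCocycle (p : C3 M N) : Prop where
  norm₁ : ∀ y z, p.1 0 y z = 0
  norm₂ : ∀ x z, p.1 x 0 z = 0
  norm₃ : ∀ x y, p.1 x y 0 = 0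
  cocycle : ∀ x y z t,
    p.1 y z t - p.1 (x + y) z t + p.1 x (y + z) t - p.1 x y (z + t) + p.1 x y z = 0
  hexagon₁ : ∀ x y z,
    p.1 x y z - p.1 y x z + p.1 y z x + p.2 x (y + z) - p.2 x y - p.2 x z = 0
  hexagon₂ : ∀ x y z,
    p.1 x y z - p.1 x z y + p.1 z x y - p.2 (x + y) z + p.2 y z + p.2 x z = 0

variable (M N)

/-- The group `Z³_ab(M, N)` of abelian 3-cocycles. -/
def Z3ab : AddSubgroup (C3 M N) where
  carrier := {p | IsAbelianCocycle p}
  zero_mem' := by constructor <;> intros <;> simp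
  add_mem' {a b} ha hb := by
    constructor
    · intro y z; simp [ha.norm₁ y z, hb.norm₁ y z]
    · intro y z; simp [ha.norm₂ y z, hb.norm₂ y z]
    · intro y z; simp [ha.norm₃ y z, hb.norm₃ y z]
    · intro x y z t
      rw [← add_zero (0 : N)]
      nth_rw 1 [← ha.cocycle x y z t]
      rw [← hb.cocycle x y z t]
      simp only [Pi.add_apply, Prod.fst_add]; abel
    · intro x y z
      rw [← add_zero (0 : N)]
      nth_rw 1 [← ha.hexagon₁ x y z]
      rw [← hb.hexagon₁ x y z]
      simp only [Pi.add_apply, Prod.fst_add, Prod.snd_add]; abel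
    · intro x y z
      rw [← add_zero (0 : N)]
      nth_rw 1 [← ha.hexagon₂ x y z]
      rw [← hb.hexagon₂ x y z]
      simp only [Pi.add_apply, Prod.fst_add, Prod.snd_add]; abel
  neg_mem' {a} ha := by
    constructor
    · intro y z; simp [ha.norm₁ y z]
    · intro y z; simp [ha.norm₂ y z]
    · intro y z; simp [ha.norm₃ y z]
    · intro x y z t
      rw [← neg_zero, ← ha.cocycle x y z t]
      simp only [Pi.neg_apply, Prod.fst_neg]; abel
    · intro x y z
      rw [← neg_zero, ← ha.hexagon₁ x y z]
      simp only [Pi.neg_apply, Prod.fst_neg, Prod.snd_neg]; abel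
    · intro x y z
      rw [← neg_zero, ← ha.hexagon₂ x y z]
      simp only [Pi.neg_apply, Prod.fst_neg, Prod.snd_neg]; abel

/-- The group of coboundaries `∂_ab g` of normalized functions `g : M² → N`. -/
def B3ab : AddSubgroup (C3 M N) := (C2 M N).map (d2 M N)

/-- Coboundaries are cocycles. -/
theorem B3ab_le_Z3ab : B3ab M N ≤ Z3ab M N := by
  rintro _ ⟨g, hg, rfl⟩
  constructor
  · intro y z; simp [d2, hg.2]
  · intro x z; simp [d2, hg.1, hg.2]
  · intro x y; simp [d2, hg.1]
  · intro x y z t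
    simp only [d2, AddMonoidHom.coe_mk, ZeroHom.coe_mk, add_assoc]; abel
  · intro x y z
    simp only [d2, AddMonoidHom.coe_mk, ZeroHom.coe_mk, add_comm y x, add_comm z x]; abel
  · intro x y z
    simp only [d2, AddMonoidHom.coe_mk, ZeroHom.coe_mk, add_comm z x, add_comm z y]; abel

/-- The third abelian cohomology group `H³_ab(M, N)`. -/
abbrev H3ab := Z3ab M N ⧸ (B3ab M N).addSubgroupOf (Z3ab M N)

/-- The group of abelian 2-cocycles: normalized functions `g : M² → N` with `∂_ab g = 0`, that is,
the symmetric normalized 2-cocycles. -/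
def Z2ab : AddSubgroup (M → M → N) := C2 M N ⊓ (d2 M N).ker

/-- The group of coboundaries `∂ t` of normalized functions `t : M → N`. -/
def B2ab : AddSubgroup (M → M → N) := (C1 M N).map (d1 M N)

/-- Coboundaries are cocycles. -/
theorem B2ab_le_Z2ab : B2ab M N ≤ Z2ab M N := by
  rintro _ ⟨t, ht, rfl⟩
  have ht : t 0 = 0 := ht
  refine ⟨⟨fun x => by simp [d1, ht], fun x => by simp [d1, ht]⟩, ?_⟩
  change d2 M N (d1 M N t) = 0
  ext x y
  · simp only [d1, d2, AddMonoidHom.coe_mk, ZeroHom.coe_mk, add_assoc, Prod.fst_zero,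
      Pi.zero_apply]
    abel
  · simp only [d1, d2, AddMonoidHom.coe_mk, ZeroHom.coe_mk, add_comm y x, Prod.snd_zero,
      Pi.zero_apply]
    abel

/-- The second abelian cohomology group `H²_ab(M, N)`. -/
abbrev H2ab := Z2ab M N ⧸ (B2ab M N).addSubgroupOf (Z2ab M N)

end Cohomology

section Functoriality

variable {M M' M'' : Type u} {N N' N'' : Type v}
  [AddCommGroup M] [AddCommGroup M'] [AddCommGroup M'']
  [AddCommGroup N] [AddCommGroup N'] [AddCommGroup N'']

/-- `(h, η) ↦ (φ^* f_* h, φ^* f_* η)` on pairs of functions. -/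
def C3map (φ : M →+ M') (f : N →+ N') : C3 M' N →+ C3 M N' where
  toFun p := (fun x y z => f (p.1 (φ x) (φ y) (φ z)), fun x y => f (p.2 (φ x) (φ y)))
  map_zero' := by ext <;> simp
  map_add' a b := by ext <;> simp

theorem C3map_mem_Z3ab (φ : M →+ M') (f : N →+ N') (p : C3 M' N) (hp : p ∈ Z3ab M' N) :
    C3map φ f p ∈ Z3ab M N' where
  norm₁ y z := by simp [C3map, hp.norm₁]
  norm₂ y z := by simp [C3map, hp.norm₂]
  norm₃ y z := by simp [C3map, hp.norm₃]
  cocycle x y z t := by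
    simpa [C3map] using congrArg f (hp.cocycle (φ x) (φ y) (φ z) (φ t))
  hexagon₁ x y z := by
    simpa [C3map] using congrArg f (hp.hexagon₁ (φ x) (φ y) (φ z))
  hexagon₂ x y z := by
    simpa [C3map] using congrArg f (hp.hexagon₂ (φ x) (φ y) (φ z))

theorem C3map_mem_B3ab (φ : M →+ M') (f : N →+ N') (p : C3 M' N) (hp : p ∈ B3ab M' N) :
    C3map φ f p ∈ B3ab M N' := by
  obtain ⟨g, hg, rfl⟩ := hp
  refine ⟨fun x y => f (g (φ x) (φ y)), ⟨fun x => by simp [hg.1], fun x => by simp [hg.2]⟩, ?_⟩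
  ext <;> simp [C3map, d2]

/-- `C3map φ f` on abelian 3-cocycles. -/
def Z3map (φ : M →+ M') (f : N →+ N') : Z3ab M' N →+ Z3ab M N' :=
  ((C3map φ f).comp (Z3ab M' N).subtype).codRestrict (Z3ab M N')
    fun p => C3map_mem_Z3ab φ f p.1 p.2

/-- The homomorphism `H³_ab(M', N) → H³_ab(M, N')` induced by `φ : M → M'` and `f : N → N'`. -/
def H3map (φ : M →+ M') (f : N →+ N') : H3ab M' N →+ H3ab M N' :=
  QuotientAddGroup.map _ _ (Z3map φ f) fun p hp => C3map_mem_B3ab φ f p.1 hp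

/-- The pullback `φ^* : H³_ab(M', N) → H³_ab(M, N)`. -/
def H3pull (N : Type v) [AddCommGroup N] (φ : M →+ M') : H3ab M' N →+ H3ab M N :=
  H3map φ (AddMonoidHom.id N)

/-- The pushforward `f_* : H³_ab(M, N) → H³_ab(M, N')`. -/
def H3push (M : Type u) [AddCommGroup M] (f : N →+ N') : H3ab M N →+ H3ab M N' :=
  H3map (AddMonoidHom.id M) f

theorem H3pull_id (c : H3ab M N) : H3pull N (AddMonoidHom.id M) c = c := by
  induction c using QuotientAddGroup.induction_on with | _ z => rfl

theorem H3push_id (c : H3ab M N) : H3push M (AddMonoidHom.id N) c = c := by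
  induction c using QuotientAddGroup.induction_on with | _ z => rfl

theorem H3pull_comp (φ : M →+ M') (φ' : M' →+ M'') (c : H3ab M'' N) :
    H3pull N (φ'.comp φ) c = H3pull N φ (H3pull N φ' c) := by
  induction c using QuotientAddGroup.induction_on with | _ z => rfl

theorem H3push_comp (f : N →+ N') (f' : N' →+ N'') (c : H3ab M N) :
    H3push M (f'.comp f) c = H3push M f' (H3push M f c) := by
  induction c using QuotientAddGroup.induction_on with | _ z => rfl

theorem H3pull_push (φ : M →+ M') (f : N →+ N') (c : H3ab M' N) :
    H3pull N' φ (H3push M' f c) = H3push M f (H3pull N φ c) := by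
  induction c using QuotientAddGroup.induction_on with | _ z => rfl

end Functoriality

/-! ### The category `H³_BGr` -/

/-- An object `(M, N, c)`, where `M`, `N` are abelian groups and `c ∈ H³_ab(M, N)`. -/
structure H3BGr : Type (max (u + 1) (v + 1)) where
  M : Type u
  N : Type v
  [grpM : AddCommGroup M]
  [grpN : AddCommGroup N]
  cls : H3ab M N

attribute [instance] H3BGr.grpM H3BGr.grpN

/-- A morphism `(M, N, c) ⟶ (M', N', c')`: a pair of homomorphisms `φ : M → M'`, `f : N → N'` with
`φ^* c' = f_* c` in `H³_ab(M, N')`. -/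
@[ext]
structure H3BGr.Hom (A B : H3BGr.{v, u}) : Type (max u v) where
  φ : A.M →+ B.M
  f : A.N →+ B.N
  compat : H3pull B.N φ B.cls = H3push A.M f A.cls

instance : Category H3BGr.{v, u} where
  Hom := H3BGr.Hom
  id A := ⟨AddMonoidHom.id _, AddMonoidHom.id _, by rw [H3pull_id, H3push_id]⟩
  comp {A B C} p q := ⟨q.φ.comp p.φ, q.f.comp p.f, by
    rw [H3pull_comp, H3push_comp, q.compat, H3pull_push, p.compat]⟩

/-! ### Braided Gr-categories and braided Gr-functors -/

/-- A braided Gr-category: a braided monoidal category in which every morphism is an isomorphism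
and every object is invertible for the tensor product. -/
structure BCG : Type (max (u + 1) (v + 1)) where
  carrier : Type u
  [cat : Category.{v} carrier]
  [monoidal : MonoidalCategory carrier]
  [braided : BraidedCategory carrier]
  [groupoid : IsGroupoid carrier]
  invertible : ∀ X : carrier, ∃ Y : carrier, Nonempty (Y ⊗ X ≅ 𝟙_ carrier)

instance : CoeSort BCG.{v, u} (Type u) := ⟨BCG.carrier⟩

attribute [instance] BCG.cat BCG.monoidal BCG.braided BCG.groupoid

/-- A braided Gr-functor: a (strong) monoidal functor which is compatible with the braidings. -/
structure BCG.Hom (A B : BCG.{v, u}) : Type (max u v) where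
  functor : A ⥤ B
  [braided : functor.Braided]

attribute [instance] BCG.Hom.braided

theorem monoidal_eq {C : Type*} {D : Type*} [Category C] [Category D] [MonoidalCategory C]
    [MonoidalCategory D] {F : C ⥤ D} (a b : F.Monoidal)
    (hε : a.toLaxMonoidal.ε = b.toLaxMonoidal.ε) (hμ : a.toLaxMonoidal.μ = b.toLaxMonoidal.μ) :
    a = b := by
  have h : a.toLaxMonoidal = b.toLaxMonoidal := Functor.LaxMonoidal.ext hε hμ
  exact Functor.Monoidal.toLaxMonoidal_injective _ h

/-- The category of braided Gr-categories and braided Gr-functors. -/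
instance : Category BCG.{v, u} where
  Hom := BCG.Hom
  id A := ⟨𝟭 A⟩
  comp F G := ⟨F.functor ⋙ G.functor⟩
  id_comp := by
    rintro A B ⟨F⟩
    change BCG.Hom.mk (𝟭 A ⋙ F) = _
    congr 1
    apply Functor.Braided.toMonoidal_injective
    apply monoidal_eq
    · change Functor.LaxMonoidal.ε (𝟭 _ ⋙ F) = Functor.LaxMonoidal.ε F
      simp
    · funext X Y
      change Functor.LaxMonoidal.μ (𝟭 _ ⋙ F) X Y = Functor.LaxMonoidal.μ F X Y
      simp
  comp_id := by
    rintro A B ⟨F⟩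
    change BCG.Hom.mk (F ⋙ 𝟭 B) = _
    congr 1
    apply Functor.Braided.toMonoidal_injective
    apply monoidal_eq
    · change Functor.LaxMonoidal.ε (F ⋙ 𝟭 _) = Functor.LaxMonoidal.ε F
      simp
    · funext X Y
      change Functor.LaxMonoidal.μ (F ⋙ 𝟭 _) X Y = Functor.LaxMonoidal.μ F X Y
      simp
  assoc := by
    rintro A B C D ⟨F⟩ ⟨G⟩ ⟨H⟩
    change BCG.Hom.mk ((F ⋙ G) ⋙ H) = BCG.Hom.mk (F ⋙ G ⋙ H)
    congr 1
    apply Functor.Braided.toMonoidal_injective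
    apply monoidal_eq
    · change Functor.LaxMonoidal.ε ((F ⋙ G) ⋙ H) = Functor.LaxMonoidal.ε (F ⋙ G ⋙ H)
      simp
    · funext X Y
      change Functor.LaxMonoidal.μ ((F ⋙ G) ⋙ H) X Y = Functor.LaxMonoidal.μ (F ⋙ G ⋙ H) X Y
      simp

/-- The underlying functor of a braided Gr-functor. -/
abbrev toFun {A B : BCG.{v, u}} (F : A ⟶ B) : A ⥤ B := BCG.Hom.functor F

/-- Two braided Gr-functors are homotopic if there is a monoidal natural isomorphism between
them. -/
def Homotopic {A B : BCG.{v, u}} (F G : A ⟶ B) : Prop :=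
  ∃ α : toFun F ≅ toFun G, NatTrans.IsMonoidal α.hom

theorem Homotopic.equivalence (A B : BCG.{v, u}) :
    Equivalence (Homotopic : (A ⟶ B) → (A ⟶ B) → Prop) where
  refl _ := ⟨Iso.refl _, NatTrans.IsMonoidal.id⟩
  symm := by
    rintro F G ⟨α, hα⟩
    exact ⟨α.symm, inferInstanceAs (NatTrans.IsMonoidal α.inv)⟩
  trans := by
    rintro F G H ⟨α, hα⟩ ⟨β, hβ⟩
    exact ⟨α ≪≫ β, inferInstanceAs (NatTrans.IsMonoidal (α.hom ≫ β.hom))⟩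

/-- A braided Gr-functor is an equivalence if it has an inverse up to homotopy. -/
def IsBraidedEquivalence {A B : BCG.{v, u}} (F : A ⟶ B) : Prop :=
  ∃ G : B ⟶ A, Homotopic (F ≫ G) (𝟙 A) ∧ Homotopic (G ≫ F) (𝟙 B)

/-! ### The invariants `π₀` and `π₁` -/

/-- `π₀ 𝔹`: the set of isomorphism classes of objects. -/
def Pi0 (B : BCG.{v, u}) : Type u := Quotient (isIsomorphicSetoid B)

/-- The class of an object in `π₀ 𝔹`. -/
def Pi0.mk {B : BCG.{v, u}} (X : B) : Pi0 B := Quotient.mk (isIsomorphicSetoid B) X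

theorem Pi0.sound {B : BCG.{v, u}} {X Y : B} (e : X ≅ Y) : Pi0.mk X = Pi0.mk Y :=
  Quotient.sound ⟨e⟩

/-- `[X] + [Y] = [X ⊗ Y]`. -/
instance (B : BCG.{v, u}) : Add (Pi0 B) :=
  ⟨Quotient.map₂ (fun X Y => X ⊗ Y) fun _ _ ⟨e⟩ _ _ ⟨e'⟩ => ⟨e ⊗ᵢ e'⟩⟩

instance (B : BCG.{v, u}) : Zero (Pi0 B) := ⟨Pi0.mk (𝟙_ B)⟩

noncomputable instance (B : BCG.{v, u}) : Neg (Pi0 B) :=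
  ⟨fun s => Pi0.mk (Classical.choose (B.invertible s.out))⟩

/-- `π₀ 𝔹` is an abelian group with the operation `[X] + [Y] = [X ⊗ Y]`. -/
noncomputable instance (B : BCG.{v, u}) : AddCommGroup (Pi0 B) where
  add_assoc := by
    rintro ⟨X⟩ ⟨Y⟩ ⟨Z⟩; exact Pi0.sound (α_ X Y Z)
  zero_add := by
    rintro ⟨X⟩; exact Pi0.sound (λ_ X)
  add_zero := by
    rintro ⟨X⟩; exact Pi0.sound (ρ_ X)
  add_comm := by
    rintro ⟨X⟩ ⟨Y⟩; exact Pi0.sound (β_ X Y)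
  neg_add_cancel s := by
    obtain ⟨e⟩ := Classical.choose_spec (B.invertible s.out)
    conv_lhs => rhs; rw [← Quotient.out_eq s]
    exact Pi0.sound e
  nsmul := nsmulRec
  zsmul := zsmulRec

theorem Pi0.mk_tensor {B : BCG.{v, u}} (X Y : B) :
    Pi0.mk (X ⊗ Y) = Pi0.mk X + Pi0.mk Y := rfl

/-- `π₁ 𝔹`: the set of automorphisms of the unit object. -/
def Pi1 (B : BCG.{v, u}) : Type v := Aut (𝟙_ B)

/-- The underlying automorphism of an element of `π₁ 𝔹`. -/
abbrev Pi1.aut {B : BCG.{v, u}} (a : Pi1 B) : 𝟙_ B ≅ 𝟙_ B := a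

theorem unit_end_comm {C : Type*} [Category C] [MonoidalCategory C] (f g : 𝟙_ C ⟶ 𝟙_ C) :
    f ≫ g = g ≫ f := by
  have h₁ : ∀ f : 𝟙_ C ⟶ 𝟙_ C, f = (ρ_ (𝟙_ C)).inv ≫ f ▷ 𝟙_ C ≫ (ρ_ (𝟙_ C)).hom := by
    intro f; simp
  have h₂ : ∀ g : 𝟙_ C ⟶ 𝟙_ C, g = (ρ_ (𝟙_ C)).inv ≫ 𝟙_ C ◁ g ≫ (ρ_ (𝟙_ C)).hom := by
    intro g; rw [← unitors_inv_equal, ← unitors_equal]; simp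
  rw [h₁ f, h₂ g]
  simp only [Category.assoc, Iso.hom_inv_id_assoc]
  rw [whisker_exchange_assoc]

instance (B : BCG.{v, u}) : Add (Pi1 B) := ⟨fun a b => a.aut ≪≫ b.aut⟩

instance (B : BCG.{v, u}) : Zero (Pi1 B) := ⟨Iso.refl _⟩

instance (B : BCG.{v, u}) : Neg (Pi1 B) := ⟨fun a => a.aut.symm⟩

/-- `π₁ 𝔹` is an abelian group with the operation given by composition. -/
instance (B : BCG.{v, u}) : AddCommGroup (Pi1 B) where
  add_assoc a b c := Iso.trans_assoc _ _ _
  zero_add a := Iso.refl_trans _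
  add_zero a := Iso.trans_refl _
  add_comm a b := Iso.ext (unit_end_comm a.aut.hom b.aut.hom)
  neg_add_cancel a := Iso.symm_self_id _
  nsmul := nsmulRec
  zsmul := zsmulRec

/-- `γ_X : π₁ 𝔹 → Aut X`, where `γ_X(u)` corresponds to `u ⊗ id_X` under `I ⊗ X ≅ X`. -/
def gam {B : BCG.{v, u}} (X : B) (a : Pi1 B) : X ⟶ X :=
  (λ_ X).inv ≫ a.aut.hom ▷ X ≫ (λ_ X).hom

/-- `F₀ : π₀ 𝔹 → π₀ 𝔹'`, `[X] ↦ [F X]`. -/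
def map0 {A B : BCG.{v, u}} (F : A ⟶ B) : Pi0 A →+ Pi0 B where
  toFun := Quotient.map (toFun F).obj fun _ _ ⟨e⟩ => ⟨(toFun F).mapIso e⟩
  map_zero' := Pi0.sound (Functor.Monoidal.εIso (toFun F)).symm
  map_add' := by
    rintro ⟨X⟩ ⟨Y⟩; exact Pi0.sound (Functor.Monoidal.μIso (toFun F) X Y).symm

/-- `F₁ : π₁ 𝔹 → π₁ 𝔹'`, `u ↦ F_*⁻¹ ∘ F u ∘ F_*`, where `F_* : I' ≅ F I`. -/
def map1 {A B : BCG.{v, u}} (F : A ⟶ B) : Pi1 A →+ Pi1 B where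
  toFun a := (Functor.Monoidal.εIso (toFun F) ≪≫ (toFun F).mapIso a.aut ≪≫
    (Functor.Monoidal.εIso (toFun F)).symm : 𝟙_ B ≅ 𝟙_ B)
  map_zero' := by
    apply Iso.ext
    change Functor.LaxMonoidal.ε (toFun F) ≫ (toFun F).map (𝟙 _) ≫
      Functor.OplaxMonoidal.η (toFun F) = 𝟙 _
    simp
  map_add' a b := by
    apply Iso.ext
    change Functor.LaxMonoidal.ε (toFun F) ≫ (toFun F).map (a.aut.hom ≫ b.aut.hom) ≫
      Functor.OplaxMonoidal.η (toFun F) =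
      (Functor.LaxMonoidal.ε (toFun F) ≫ (toFun F).map a.aut.hom ≫
        Functor.OplaxMonoidal.η (toFun F)) ≫
      Functor.LaxMonoidal.ε (toFun F) ≫ (toFun F).map b.aut.hom ≫
        Functor.OplaxMonoidal.η (toFun F)
    simp

theorem map0_id (A : BCG.{v, u}) : map0 (𝟙 A) = AddMonoidHom.id (Pi0 A) := by
  ext s; induction s using Quotient.inductionOn; rfl

theorem map0_comp {A B C : BCG.{v, u}} (F : A ⟶ B) (G : B ⟶ C) :
    map0 (F ≫ G) = (map0 G).comp (map0 F) := by
  ext s; induction s using Quotient.inductionOn; rfl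

theorem map1_id (A : BCG.{v, u}) : map1 (𝟙 A) = AddMonoidHom.id (Pi1 A) := by
  ext a
  apply Iso.ext
  change 𝟙 _ ≫ a.aut.hom ≫ 𝟙 _ = a.aut.hom
  simp

theorem map1_comp {A B C : BCG.{v, u}} (F : A ⟶ B) (G : B ⟶ C) :
    map1 (F ≫ G) = (map1 G).comp (map1 F) := by
  ext a
  apply Iso.ext
  change Functor.LaxMonoidal.ε (toFun F ⋙ toFun G) ≫ (toFun G).map ((toFun F).map a.aut.hom) ≫
      Functor.OplaxMonoidal.η (toFun F ⋙ toFun G) =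
    Functor.LaxMonoidal.ε (toFun G) ≫ (toFun G).map (Functor.LaxMonoidal.ε (toFun F) ≫
      (toFun F).map a.aut.hom ≫ Functor.OplaxMonoidal.η (toFun F)) ≫
        Functor.OplaxMonoidal.η (toFun G)
  simp

/-! ### The class of a braided Gr-category in `H³_ab(π₀ 𝔹, π₁ 𝔹)` -/

/-- A stick of `𝔹`: a representative `X_s` for each `s ∈ π₀ 𝔹`, where the representative of the
class of the unit object is identified with the unit object, and isomorphisms
`i_{s,t} : X_s ⊗ X_t ≅ X_{s+t}` which are the unit constraints for `s = 0` or `t = 0`. -/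
structure Stick (B : BCG.{v, u}) where
  rep : Pi0 B → B
  rep_mem : ∀ s, Pi0.mk (rep s) = s
  unit : 𝟙_ B ≅ rep 0
  i : ∀ {s t r : Pi0 B}, s + t = r → (rep s ⊗ rep t ≅ rep r)
  i_zero_left : ∀ t, (i (zero_add t)).hom = unit.inv ▷ rep t ≫ (λ_ (rep t)).hom
  i_zero_right : ∀ s, (i (add_zero s)).hom = rep s ◁ unit.inv ≫ (ρ_ (rep s)).hom

/-- `(h, η)` is the pair of the associativity constraint and the braiding of the reduced braided
Gr-category which the stick defines, that is, the following diagrams commute: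
`(X_s ⊗ X_t) ⊗ X_r ⟶ X_{s+t} ⊗ X_r ⟶ X_{s+t+r} ⟶ X_{s+t+r}`, with last arrow `γ(h(s,t,r))`,
against `(X_s ⊗ X_t) ⊗ X_r ⟶ X_s ⊗ (X_t ⊗ X_r) ⟶ X_s ⊗ X_{t+r} ⟶ X_{s+t+r}`, and
`X_s ⊗ X_t ⟶ X_{s+t} ⟶ X_{s+t}`, with last arrow `γ(η(s,t))`,
against `X_s ⊗ X_t ⟶ X_t ⊗ X_s ⟶ X_{s+t}`. -/
structure Stick.HasConstraints {B : BCG.{v, u}} (S : Stick B) (p : C3 (Pi0 B) (Pi1 B)) : Prop where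
  assoc : ∀ s t r : Pi0 B,
    (S.i (rfl : s + t = s + t)).hom ▷ S.rep r ≫ (S.i (rfl : (s + t) + r = s + t + r)).hom ≫
        gam (S.rep (s + t + r)) (p.1 s t r) =
      (α_ (S.rep s) (S.rep t) (S.rep r)).hom ≫ S.rep s ◁ (S.i (rfl : t + r = t + r)).hom ≫
        (S.i (add_assoc s t r).symm).hom
  braiding : ∀ s t : Pi0 B,
    (S.i (rfl : s + t = s + t)).hom ≫ gam (S.rep (s + t)) (p.2 s t) =
      (β_ (S.rep s) (S.rep t)).hom ≫ (S.i (add_comm t s)).hom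

/-- `c` is the class `[(h, η)_𝔹]`: `𝔹` has sticks, and for every stick the pair `(h, η)` of its
constraints is an abelian 3-cocycle of class `c`. -/
def IsClassOf (B : BCG.{v, u}) (c : H3ab (Pi0 B) (Pi1 B)) : Prop :=
  Nonempty (Stick B) ∧ ∀ S : Stick B, ∃ z : Z3ab (Pi0 B) (Pi1 B),
    S.HasConstraints z.1 ∧ (QuotientAddGroup.mk z : H3ab (Pi0 B) (Pi1 B)) = c

/-- The functor `𝔹 ↦ (π₀ 𝔹, π₁ 𝔹, c_𝔹)`, `F ↦ (F₀, F₁)`, for a family of classes `c_𝔹` which is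
compatible with the pairs `(F₀, F₁)`. -/
@[simps]
noncomputable def classifyingFunctor (c : ∀ B : BCG.{v, u}, H3ab (Pi0 B) (Pi1 B))
    (hc : ∀ (A B : BCG.{v, u}) (F : A ⟶ B),
      H3pull (Pi1 B) (map0 F) (c B) = H3push (Pi0 A) (map1 F) (c A)) :
    BCG.{v, u} ⥤ H3BGr.{v, u} where
  obj B := ⟨Pi0 B, Pi1 B, c B⟩
  map F := ⟨map0 F, map1 F, hc _ _ F⟩
  map_id A := H3BGr.Hom.ext (map0_id A) (map1_id A)
  map_comp F G := H3BGr.Hom.ext (map0_comp F G) (map1_comp F G)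

/-- Homotopy on the set of braided Gr-functors `𝔹 ⟶ 𝔹'` which induce the pair `(φ, f)`. -/
def homotopySetoid {A B : BCG.{v, u}} (φ : Pi0 A →+ Pi0 B) (f : Pi1 A →+ Pi1 B) :
    Setoid {F : A ⟶ B // map0 F = φ ∧ map1 F = f} where
  r F G := Homotopic F.1 G.1
  iseqv := (Homotopic.equivalence A B).comap Subtype.val

/-- `Hom^Br_(φ,f)[𝔹, 𝔹']`: the set of homotopy classes of braided Gr-functors `𝔹 ⟶ 𝔹'` which
induce the pair `(φ, f)`. -/
def HomClasses {A B : BCG.{v, u}} (φ : Pi0 A →+ Pi0 B) (f : Pi1 A →+ Pi1 B) : Type (max u v) :=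
  Quotient (homotopySetoid φ f)

end BrGr

open BrGr

/-! Every object is invertible and every morphism is an isomorphism, so `π₁` acts simply
transitively on each nonempty hom-set (`exists_tw`, `tw_inj`). The action is compatible with
composition, with both sides of `⊗`, and with functors along `F₁`. A diagram in `𝔹` that need not
commute is therefore measured by one element of `π₁`, and each coherence axiom becomes an additive
identity between such elements.

Applied to a stick, the pentagon and the hexagons say that `(h, η)` is an abelian 3-cocycle. Applied
to a functor `F` and sticks of its source and target, the tensor constraint becomes a cochain `g`
with `f_* p = φ^* q + ∂_ab g` (`Stick.HasConstraints.comparison`). For `F = 𝟙` this is independence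
of the stick; for general `F` it makes `dF` a morphism.

Conversely, a cocycle is the constraint data of a category with objects `M` and automorphism groups
`N`, and a cochain `g` as above is the tensor constraint of a functor out of that category. This
gives essential surjectivity. It also gives fullness, since `dF` is invertible exactly when `F` is
an equivalence, and so every `𝔹` is equivalent to the reduced category of its own cocycle.

Two functors inducing the same pair are naturally isomorphic, and their tensor constraints then
differ by a symmetric 2-cocycle, determined up to the coboundaries that come from natural
automorphisms. Fullness supplies a base point for this torsor under `H²_ab`. Since `H²_ab` can be
nonzero, `d` is not faithful. -/

namespace BrGr

open Functor.LaxMonoidal Functor.OplaxMonoidal Functor.Monoidal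

/-! ### The simply transitive action of `π₁` on hom-sets -/

section Action

variable {A B : BCG.{v, u}}

theorem gam_naturality {X Y : B} (f : X ⟶ Y) (a : Pi1 B) : gam X a ≫ f = f ≫ gam Y a := by
  simp only [gam, Category.assoc]
  rw [← leftUnitor_naturality, ← whisker_exchange_assoc, ← leftUnitor_inv_naturality_assoc]

theorem gam_zero (X : B) : gam X 0 = 𝟙 X := by
  change (λ_ X).inv ≫ (𝟙 (𝟙_ B)) ▷ X ≫ (λ_ X).hom = _
  simp

theorem gam_add (X : B) (a b : Pi1 B) : gam X (a + b) = gam X a ≫ gam X b := by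
  change (λ_ X).inv ≫ (a.aut.hom ≫ b.aut.hom) ▷ X ≫ (λ_ X).hom = _
  simp [gam]

theorem gam_whiskerRight (X Y : B) (a : Pi1 B) : gam X a ▷ Y = gam (X ⊗ Y) a := by
  simp [gam]

/-- The braiding turns left whiskering into right whiskering. Without it, the left and right actions
of `π₁` could differ by an action of `π₀`. -/
theorem gam_whiskerLeft (X Y : B) (a : Pi1 B) : X ◁ gam Y a = gam (X ⊗ Y) a := by
  rw [← cancel_mono (β_ X Y).hom, BraidedCategory.braiding_naturality_right, gam_whiskerRight,
    gam_naturality]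

theorem gam_unit (a : Pi1 B) : gam (𝟙_ B) a = a.aut.hom := by
  rw [gam, unitors_equal, rightUnitor_naturality, unitors_inv_equal, Iso.inv_hom_id_assoc]

/-- Tensoring with an inverse of `X` moves the question to the unit object, where `gam` is the
automorphism itself. -/
theorem gam_injective (X : B) : Function.Injective (gam X) := by
  intro a b h
  obtain ⟨Y, ⟨e⟩⟩ := B.invertible X
  have h : gam (Y ⊗ X) a = gam (Y ⊗ X) b := by
    rw [← gam_whiskerLeft, ← gam_whiskerLeft, h]
  have h : e.hom ≫ gam (𝟙_ B) a = e.hom ≫ gam (𝟙_ B) b := by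
    rw [← gam_naturality, ← gam_naturality, h]
  rw [cancel_epi, gam_unit, gam_unit] at h
  exact Iso.ext h

theorem whiskerLeft_injective (Y : B) {X Z : B} {f g : X ⟶ Z} (h : Y ◁ f = Y ◁ g) : f = g := by
  obtain ⟨W, ⟨e⟩⟩ := B.invertible Y
  have h : (W ⊗ Y) ◁ f = (W ⊗ Y) ◁ g := by simp [h]
  have h : e.hom ▷ X ≫ 𝟙_ B ◁ f = e.hom ▷ X ≫ 𝟙_ B ◁ g := by
    rw [← whisker_exchange, ← whisker_exchange, h]
  rw [cancel_epi] at h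
  simpa using h

theorem gam_surjective (X : B) : Function.Surjective (gam X) := by
  intro w
  obtain ⟨Y, ⟨e⟩⟩ := B.invertible X
  let a : Pi1 B := (e.symm ≪≫ asIso (Y ◁ w) ≪≫ e : 𝟙_ B ≅ 𝟙_ B)
  refine ⟨a, whiskerLeft_injective Y ?_⟩
  rw [gam_whiskerLeft, ← cancel_mono e.hom, gam_naturality, gam_unit]
  simp [a, Pi1.aut]

theorem map_gam (F : A ⟶ B) (X : A) (a : Pi1 A) :
    (toFun F).map (gam X a) = gam ((toFun F).obj X) (map1 F a) := by
  have h : (map1 F a).aut.hom = ε (toFun F) ≫ (toFun F).map a.aut.hom ≫ η (toFun F) := rfl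
  rw [gam, gam, h]
  simp only [comp_whiskerRight, Category.assoc, Functor.map_comp, map_whiskerRight,
    map_leftUnitor]
  simp

/-- The action of `π₁ 𝔹` on the morphisms of `𝔹`. -/
def tw (a : Pi1 B) {X Y : B} (f : X ⟶ Y) : X ⟶ Y := f ≫ gam Y a

-- The simp lemmas from here on pull every twist to the outside and add them up. The two paths of a
-- diagram then become twists of one common arrow, and `tw_inj` reads off an equation in `π₁`.
@[simp] theorem tw_comp (a : Pi1 B) {X Y Z : B} (f : X ⟶ Y) (g : Y ⟶ Z) :
    tw a f ≫ g = tw a (f ≫ g) := by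
  simp [tw, gam_naturality]

@[simp] theorem comp_tw (a : Pi1 B) {X Y Z : B} (f : X ⟶ Y) (g : Y ⟶ Z) :
    f ≫ tw a g = tw a (f ≫ g) := by
  simp [tw]

@[simp] theorem tw_whiskerRight (a : Pi1 B) {X Y : B} (f : X ⟶ Y) (Z : B) :
    tw a f ▷ Z = tw a (f ▷ Z) := by
  simp [tw, gam_whiskerRight]

@[simp] theorem whiskerLeft_tw (a : Pi1 B) {X Y : B} (f : X ⟶ Y) (Z : B) :
    Z ◁ tw a f = tw a (Z ◁ f) := by
  simp [tw, gam_whiskerLeft]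

@[simp] theorem tw_tw (a b : Pi1 B) {X Y : B} (f : X ⟶ Y) : tw a (tw b f) = tw (a + b) f := by
  rw [add_comm, tw, tw, tw, gam_add, Category.assoc]

@[simp] theorem tw_tensorHom (a : Pi1 B) {X Y X' Y' : B} (f : X ⟶ Y) (g : X' ⟶ Y') :
    tw a f ⊗ₘ g = tw a (f ⊗ₘ g) := by
  simp [MonoidalCategory.tensorHom_def]

@[simp] theorem tensorHom_tw (a : Pi1 B) {X Y X' Y' : B} (f : X ⟶ Y) (g : X' ⟶ Y') :
    f ⊗ₘ tw a g = tw a (f ⊗ₘ g) := by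
  simp [MonoidalCategory.tensorHom_def]

@[simp] theorem tw_zero {X Y : B} (f : X ⟶ Y) : tw 0 f = f := by simp [tw, gam_zero]

@[simp] theorem map_tw (F : A ⟶ B) (a : Pi1 A) {X Y : A} (f : X ⟶ Y) :
    (toFun F).map (tw a f) = tw (map1 F a) ((toFun F).map f) := by
  simp [tw, map_gam]

theorem gam_eq_tw (X : B) (a : Pi1 B) : gam X a = tw a (𝟙 X) := by simp [tw]

theorem tw_left_injective {X Y : B} (f : X ⟶ Y) {a b : Pi1 B} (h : tw a f = tw b f) : a = b :=
  gam_injective Y ((cancel_epi f).1 h)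

@[simp] theorem tw_inj {X Y : B} (f : X ⟶ Y) {a b : Pi1 B} : tw a f = tw b f ↔ a = b :=
  ⟨tw_left_injective f, fun h => by rw [h]⟩

/-- The source of all cochains below: `h`, `η`, `g` and `t` are each chosen from this existence
statement. -/
theorem exists_tw {X Y : B} (f g : X ⟶ Y) : ∃ a : Pi1 B, tw a f = g := by
  obtain ⟨a, ha⟩ := gam_surjective Y (inv f ≫ g)
  exact ⟨a, by simp [tw, ha]⟩

end Action

/-! ### Sticks and the cocycle conditions -/

section Sticks

variable {A B : BCG.{v, u}}

theorem Pi0.iso_of_eq {X Y : B} (h : Pi0.mk X = Pi0.mk Y) : Nonempty (X ≅ Y) := Quotient.exact h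

namespace Stick

/-- Both unit conditions bear on the same isomorphism only at `s = t = 0`, where they agree because
`λ_I = ρ_I`. -/
theorem nonempty (B : BCG.{v, u}) : Nonempty (Stick B) := by
  let rep : Pi0 B → B := Quotient.out
  have hrep : ∀ s, Pi0.mk (rep s) = s := Quotient.out_eq
  obtain ⟨e⟩ : Nonempty (𝟙_ B ≅ rep 0) := Pi0.iso_of_eq (hrep 0).symm
  have key : ∀ (s t r : Pi0 B) (_ : s + t = r), ∃ j : rep s ⊗ rep t ≅ rep r,
      (∀ (hs : s = 0) (ht : t = r),
        j.hom = (eqToHom (congrArg rep hs) ≫ e.inv) ▷ rep t ≫ (λ_ (rep t)).hom ≫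
          eqToHom (congrArg rep ht)) ∧
      (∀ (ht : t = 0) (hs : s = r),
        j.hom = rep s ◁ (eqToHom (congrArg rep ht) ≫ e.inv) ≫ (ρ_ (rep s)).hom ≫
          eqToHom (congrArg rep hs)) := by
    intro s t r h
    by_cases hs : s = 0
    · subst hs
      obtain rfl : t = r := by rw [← h, zero_add]
      refine ⟨whiskerRightIso e.symm _ ≪≫ λ_ _, fun _ _ => by simp, ?_⟩
      rintro rfl _
      simp only [Iso.trans_hom, whiskerRightIso_hom, Iso.symm_hom, eqToHom_refl, Category.id_comp,
        Category.comp_id]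
      -- After composing with `e.inv`, naturality of the unitors and the exchange law bring both
      -- sides to `I ⊗ I`.
      rw [← cancel_mono e.inv]
      simp only [Category.assoc]
      rw [← leftUnitor_naturality, ← rightUnitor_naturality, unitors_equal, whisker_exchange_assoc]
    · by_cases ht : t = 0
      · subst ht
        obtain rfl : s = r := by rw [← h, add_zero]
        exact ⟨whiskerLeftIso _ e.symm ≪≫ ρ_ _, fun h' => absurd h' hs, fun _ _ => by simp⟩
      · obtain ⟨j⟩ : Nonempty (rep s ⊗ rep t ≅ rep r) := Pi0.iso_of_eq (by
          rw [Pi0.mk_tensor, hrep, hrep, hrep, h])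
        exact ⟨j, fun h' => absurd h' hs, fun h' => absurd h' ht⟩
  choose j hj₁ hj₂ using key
  exact ⟨{
    rep := rep
    rep_mem := hrep
    unit := e
    i := fun {s t r} h => j s t r h
    i_zero_left := fun t => by simpa using hj₁ 0 t t (zero_add t) rfl rfl
    i_zero_right := fun s => by simpa using hj₂ s 0 s (add_zero s) rfl rfl }⟩

variable (S : Stick B)

/-- The identification of the unit object with the representative of `z`, where `z = 0`. -/
def unitOf {z : Pi0 B} (hz : z = 0) : 𝟙_ B ≅ S.rep z :=
  S.unit ≪≫ eqToIso (congrArg S.rep hz.symm)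

/-- Needed for indices such as `φ 0`, which are only provably zero. -/
theorem i_left {z t r : Pi0 B} (hz : z = 0) (h : z + t = r) (ht : t = r) :
    (S.i h).hom = (S.unitOf hz).inv ▷ S.rep t ≫ (λ_ (S.rep t)).hom ≫
      eqToHom (congrArg S.rep ht) := by
  subst hz ht
  simp [unitOf, S.i_zero_left]

theorem i_right {z t r : Pi0 B} (hz : z = 0) (h : t + z = r) (ht : t = r) :
    (S.i h).hom = S.rep t ◁ (S.unitOf hz).inv ≫ (ρ_ (S.rep t)).hom ≫
      eqToHom (congrArg S.rep ht) := by
  subst hz ht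
  simp [unitOf, S.i_zero_right]

theorem i_eqToHom {s t r r' : Pi0 B} (h : s + t = r) (h' : r = r') :
    (S.i h).hom ≫ eqToHom (congrArg S.rep h') = (S.i (h.trans h')).hom := by
  subst h'; simp

theorem eqToHom_i_left {s s' t r : Pi0 B} (h : s' = s) (h' : s + t = r) :
    eqToHom (congrArg S.rep h) ▷ S.rep t ≫ (S.i h').hom = (S.i (h ▸ h')).hom := by
  subst h; simp

theorem eqToHom_i_right {s t t' r : Pi0 B} (h : t' = t) (h' : s + t = r) :
    S.rep s ◁ eqToHom (congrArg S.rep h) ≫ (S.i h').hom = (S.i (h ▸ h')).hom := by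
  subst h; simp

theorem exists_hasConstraints : ∃ p, S.HasConstraints p := by
  have h₁ := fun s t r : Pi0 B => exists_tw
    ((S.i (rfl : s + t = s + t)).hom ▷ S.rep r ≫ (S.i (rfl : (s + t) + r = s + t + r)).hom)
    ((α_ (S.rep s) (S.rep t) (S.rep r)).hom ≫ S.rep s ◁ (S.i (rfl : t + r = t + r)).hom ≫
        (S.i (add_assoc s t r).symm).hom)
  have h₂ := fun s t : Pi0 B => exists_tw (S.i (rfl : s + t = s + t)).hom
    ((β_ (S.rep s) (S.rep t)).hom ≫ (S.i (add_comm t s)).hom)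
  choose h hh using h₁
  choose e he using h₂
  exact ⟨(h, e), fun s t r => by rw [← hh, tw, Category.assoc], fun s t => by rw [← he, tw]⟩

variable {S} {p : C3 (Pi0 B) (Pi1 B)}

/-- Partial sums are free variables tied by equations, so differently bracketed indices can be used
without transport. -/
theorem HasConstraints.assoc' (hp : S.HasConstraints p) {s t r st tr str : Pi0 B}
    (h₁ : s + t = st) (h₂ : st + r = str) (h₃ : t + r = tr) (h₄ : s + tr = str) :
    (α_ (S.rep s) (S.rep t) (S.rep r)).hom ≫ S.rep s ◁ (S.i h₃).hom ≫ (S.i h₄).hom =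
      tw (p.1 s t r) ((S.i h₁).hom ▷ S.rep r ≫ (S.i h₂).hom) := by
  subst h₁ h₂ h₃
  rw [← hp.assoc, tw, Category.assoc]

theorem HasConstraints.braiding' (hp : S.HasConstraints p) {s t r : Pi0 B}
    (h₁ : s + t = r) (h₂ : t + s = r) :
    (β_ (S.rep s) (S.rep t)).hom ≫ (S.i h₂).hom = tw (p.2 s t) (S.i h₁).hom := by
  subst h₁
  exact (hp.braiding s t).symm

/-- Normalization is unit coherence. For the other conditions, both sides of the pentagon or hexagon
are followed by the isomorphisms `i` down to a single representative; each side is then a twist of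
the same arrow, and the twists are compared. -/
theorem HasConstraints.isAbelianCocycle (hp : S.HasConstraints p) : IsAbelianCocycle p where
  norm₁ t r := by
    have h := hp.assoc' (zero_add t) (rfl : t + r = t + r) rfl (zero_add (t + r))
    rw [S.i_left rfl (zero_add t) rfl, S.i_left rfl (zero_add (t + r)) rfl] at h
    apply tw_left_injective _ (h.symm.trans _)
    simp [whisker_exchange_assoc]
  norm₂ s r := by
    have h := hp.assoc' (add_zero s) (rfl : s + r = s + r) (zero_add r) rfl
    rw [S.i_left rfl (zero_add r) rfl, S.i_right rfl (add_zero s) rfl] at h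
    apply tw_left_injective _ (h.symm.trans _)
    simp
  norm₃ s t := by
    have h := hp.assoc' (rfl : s + t = s + t) (add_zero (s + t)) (add_zero t) rfl
    rw [S.i_right rfl (add_zero t) rfl, S.i_right rfl (add_zero (s + t)) rfl] at h
    apply tw_left_injective _ (h.symm.trans _)
    simp [← whisker_exchange_assoc]
  cocycle s t r q := by
    have e₁ := hp.assoc' (rfl : t + r = t + r) rfl (rfl : r + q = r + q) (add_assoc t r q).symm
    have e₂ := hp.assoc' (rfl : s + (t + r) = s + (t + r)) rfl (rfl : t + r + q = t + r + q)
      (add_assoc s (t + r) q).symm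
    have e₃ := hp.assoc' (rfl : s + t = s + t) (add_assoc s t r) (rfl : t + r = t + r) rfl
    have e₄ := hp.assoc' (rfl : s + t = s + t) (by rw [add_assoc s (t + r), add_assoc t, add_assoc])
      (add_assoc t r q).symm (add_assoc s (t + r) q).symm
    have e₅ := hp.assoc' (add_assoc s t r) rfl (rfl : r + q = r + q)
      (by rw [add_assoc s (t + r), add_assoc t, add_assoc] : s + t + (r + q) = s + (t + r) + q)
    have left : (α_ (S.rep s) (S.rep t) (S.rep r)).hom ▷ S.rep q ≫
        (α_ (S.rep s) (S.rep t ⊗ S.rep r) (S.rep q)).hom ≫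
        S.rep s ◁ (α_ (S.rep t) (S.rep r) (S.rep q)).hom ≫
        S.rep s ◁ S.rep t ◁ (S.i (rfl : r + q = r + q)).hom ≫
        S.rep s ◁ (S.i (add_assoc t r q).symm).hom ≫ (S.i (add_assoc s (t + r) q).symm).hom =
        tw (p.1 t r q + p.1 s (t + r) q + p.1 s t r)
          ((S.i (rfl : s + t = s + t)).hom ▷ S.rep r ▷ S.rep q ≫
            (S.i (add_assoc s t r)).hom ▷ S.rep q ≫ (S.i rfl).hom) := by
      have e₁ := congrArg (S.rep s ◁ ·) e₁
      have e₃ := congrArg (· ▷ S.rep q) e₃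
      simp only [whiskerLeft_comp, comp_whiskerRight, whiskerLeft_tw, tw_whiskerRight] at e₁ e₃
      rw [reassoc_of% e₁]
      simp only [tw_comp, comp_tw, Category.assoc]
      rw [← associator_naturality_middle_assoc, e₂]
      simp only [comp_tw, tw_tw]
      rw [reassoc_of% e₃]
      simp only [tw_comp, Category.assoc, tw_tw]
    have right : (α_ (S.rep s ⊗ S.rep t) (S.rep r) (S.rep q)).hom ≫
        (α_ (S.rep s) (S.rep t) (S.rep r ⊗ S.rep q)).hom ≫
        S.rep s ◁ S.rep t ◁ (S.i (rfl : r + q = r + q)).hom ≫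
        S.rep s ◁ (S.i (add_assoc t r q).symm).hom ≫ (S.i (add_assoc s (t + r) q).symm).hom =
        tw (p.1 s t (r + q) + p.1 (s + t) r q)
          ((S.i (rfl : s + t = s + t)).hom ▷ S.rep r ▷ S.rep q ≫
            (S.i (add_assoc s t r)).hom ▷ S.rep q ≫ (S.i rfl).hom) := by
      rw [← associator_naturality_right_assoc, e₄]
      simp only [comp_tw]
      rw [whisker_exchange_assoc, ← associator_naturality_left_assoc, e₅]
      simp only [comp_tw, tw_tw]
    rw [← pentagon_assoc, left, tw_inj] at right
    rw [← sub_eq_zero] at right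
    rw [← right]; abel
  hexagon₁ x y z := by
    have e₁ := hp.assoc' (rfl : y + z = y + z) (by rw [add_comm, add_assoc]) (rfl : z + x = z + x)
      (by rw [add_comm z, ← add_assoc, add_comm y] : y + (z + x) = x + y + z)
    have e₂ := hp.braiding' (add_assoc x y z).symm
      (by rw [add_comm, add_assoc] : y + z + x = x + y + z)
    have e₃ := hp.assoc' (rfl : x + y = x + y) rfl (rfl : y + z = y + z) (add_assoc x y z).symm
    have e₄ := hp.braiding' (rfl : x + z = x + z) (add_comm z x)
    have e₅ := hp.assoc' (add_comm y x) rfl (rfl : x + z = x + z)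
      (by rw [← add_assoc, add_comm y] : y + (x + z) = x + y + z)
    have e₆ := hp.braiding' (rfl : x + y = x + y) (add_comm y x)
    have left : (α_ (S.rep x) (S.rep y) (S.rep z)).hom ≫
        (β_ (S.rep x) (S.rep y ⊗ S.rep z)).hom ≫ (α_ (S.rep y) (S.rep z) (S.rep x)).hom ≫
        S.rep y ◁ (S.i (rfl : z + x = z + x)).hom ≫
        (S.i (by rw [add_comm z, ← add_assoc, add_comm y] : y + (z + x) = x + y + z)).hom =
        tw (p.1 y z x + p.2 x (y + z) + p.1 x y z)
          ((S.i (rfl : x + y = x + y)).hom ▷ S.rep z ≫ (S.i rfl).hom) := by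
      rw [e₁, comp_tw, ← BraidedCategory.braiding_naturality_right_assoc, e₂]
      simp only [comp_tw, tw_tw]
      rw [e₃, tw_tw]
    have right : (β_ (S.rep x) (S.rep y)).hom ▷ S.rep z ≫
        (α_ (S.rep y) (S.rep x) (S.rep z)).hom ≫ S.rep y ◁ (β_ (S.rep x) (S.rep z)).hom ≫
        S.rep y ◁ (S.i (rfl : z + x = z + x)).hom ≫
        (S.i (by rw [add_comm z, ← add_assoc, add_comm y] : y + (z + x) = x + y + z)).hom =
        tw (p.2 x z + p.1 y x z + p.2 x y)
          ((S.i (rfl : x + y = x + y)).hom ▷ S.rep z ≫ (S.i rfl).hom) := by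
      have e₄ := congrArg (S.rep y ◁ ·) e₄
      have e₆ := congrArg (· ▷ S.rep z) e₆
      simp only [whiskerLeft_comp, comp_whiskerRight, whiskerLeft_tw, tw_whiskerRight] at e₄ e₆
      -- The index `z + x` is replaced by `x + z`; the two transports cancel.
      have e₇ : S.rep y ◁ (S.i (rfl : z + x = z + x)).hom ≫
        (S.i (by rw [add_comm z, ← add_assoc, add_comm y] : y + (z + x) = x + y + z)).hom =
        S.rep y ◁ (S.i (add_comm z x)).hom ≫
        (S.i (by rw [← add_assoc, add_comm y] : y + (x + z) = x + y + z)).hom := by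
        rw [← S.i_eqToHom rfl (add_comm z x), whiskerLeft_comp, Category.assoc,
          S.eqToHom_i_right (add_comm z x)]
      rw [e₇, reassoc_of% e₄, tw_comp, comp_tw, e₅]
      simp only [comp_tw, tw_tw]
      rw [reassoc_of% e₆]
      simp only [tw_comp, tw_tw]
    rw [← BraidedCategory.hexagon_forward_assoc, left, tw_inj, ← sub_eq_zero] at right
    rw [← right]; abel
  hexagon₂ x y z := by
    -- The reverse hexagon contains inverse associators, which contribute `-h`.
    have inv' {s t r st tr str : Pi0 B} (h₁ : s + t = st) (h₂ : st + r = str) (h₃ : t + r = tr)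
        (h₄ : s + tr = str) :
        (α_ (S.rep s) (S.rep t) (S.rep r)).inv ≫ (S.i h₁).hom ▷ S.rep r ≫ (S.i h₂).hom =
          tw (-p.1 s t r) (S.rep s ◁ (S.i h₃).hom ≫ (S.i h₄).hom) := by
      rw [Iso.inv_comp_eq, comp_tw, hp.assoc' h₁ h₂ h₃ h₄, tw_tw, neg_add_cancel, tw_zero]
    have e₁ := inv' (rfl : z + x = z + x) (by rw [add_comm z, add_assoc, add_comm z])
      (rfl : x + y = x + y) (by rw [add_comm z, add_assoc] : z + (x + y) = x + (y + z))
    have e₂ := hp.braiding' (add_assoc x y z)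
      (by rw [add_comm z, add_assoc] : z + (x + y) = x + (y + z))
    have e₃ := inv' (rfl : x + y = x + y) (add_assoc x y z) (rfl : y + z = y + z) rfl
    have e₄ := hp.braiding' (rfl : x + z = x + z) (add_comm z x)
    have e₅ := inv' (rfl : x + z = x + z) (by rw [add_assoc, add_comm z]) (add_comm z y)
      (rfl : x + (y + z) = x + (y + z))
    have e₆ := hp.braiding' (rfl : y + z = y + z) (add_comm z y)
    have left : (α_ (S.rep x) (S.rep y) (S.rep z)).inv ≫
        (β_ (S.rep x ⊗ S.rep y) (S.rep z)).hom ≫ (α_ (S.rep z) (S.rep x) (S.rep y)).inv ≫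
        (S.i (rfl : z + x = z + x)).hom ▷ S.rep y ≫
        (S.i (by rw [add_comm z, add_assoc, add_comm z] : z + x + y = x + (y + z))).hom =
        tw (-p.1 z x y + p.2 (x + y) z - p.1 x y z)
          (S.rep x ◁ (S.i (rfl : y + z = y + z)).hom ≫ (S.i rfl).hom) := by
      rw [e₁, comp_tw, ← BraidedCategory.braiding_naturality_left_assoc, e₂]
      simp only [comp_tw, tw_tw]
      rw [e₃, tw_tw, sub_eq_add_neg]
    have right : S.rep x ◁ (β_ (S.rep y) (S.rep z)).hom ≫
        (α_ (S.rep x) (S.rep z) (S.rep y)).inv ≫ (β_ (S.rep x) (S.rep z)).hom ▷ S.rep y ≫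
        (S.i (rfl : z + x = z + x)).hom ▷ S.rep y ≫
        (S.i (by rw [add_comm z, add_assoc, add_comm z] : z + x + y = x + (y + z))).hom =
        tw (p.2 x z - p.1 x z y + p.2 y z)
          (S.rep x ◁ (S.i (rfl : y + z = y + z)).hom ≫ (S.i rfl).hom) := by
      have e₄ := congrArg (· ▷ S.rep y) e₄
      have e₆ := congrArg (S.rep x ◁ ·) e₆
      simp only [whiskerLeft_comp, comp_whiskerRight, whiskerLeft_tw, tw_whiskerRight] at e₄ e₆
      have e₇ : (S.i (rfl : z + x = z + x)).hom ▷ S.rep y ≫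
        (S.i (by rw [add_comm z, add_assoc, add_comm z] : z + x + y = x + (y + z))).hom =
        (S.i (add_comm z x)).hom ▷ S.rep y ≫
        (S.i (by rw [add_assoc, add_comm z] : x + z + y = x + (y + z))).hom := by
        rw [← S.i_eqToHom rfl (add_comm z x), comp_whiskerRight, Category.assoc,
          S.eqToHom_i_left (add_comm z x)]
      rw [e₇, reassoc_of% e₄, tw_comp, comp_tw, e₅]
      simp only [comp_tw, tw_tw]
      rw [reassoc_of% e₆]
      simp only [tw_comp, tw_tw, sub_eq_add_neg]
    rw [← BraidedCategory.hexagon_reverse_assoc, left, tw_inj, ← sub_eq_zero] at right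
    rw [← neg_eq_zero, ← right]; abel

end Stick
end Sticks

/-! ### Effect of a functor on cocycles; the class of `𝔹` -/

section Comparison

variable {A B : BCG.{v, u}}

theorem Stick.exists_comparison (F : A ⟶ B) (S : Stick A) (T : Stick B) :
    ∃ θ : ∀ s, (toFun F).obj (S.rep s) ≅ T.rep (map0 F s),
      ε (toFun F) ≫ (toFun F).map S.unit.hom ≫ (θ 0).hom =
        (T.unitOf (map_zero (map0 F))).hom := by
  have h : ∀ s, Nonempty ((toFun F).obj (S.rep s) ≅ T.rep (map0 F s)) := fun s =>
    Pi0.iso_of_eq (by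
      rw [T.rep_mem]; conv_rhs => rw [← S.rep_mem s]
      rfl)
  let θ := fun s => (h s).some
  -- The isomorphisms `θ s` are arbitrary so far. Twisting the whole family by the element that
  -- corrects `θ 0` makes it compatible with the units.
  obtain ⟨a, ha⟩ := exists_tw (ε (toFun F) ≫ (toFun F).map S.unit.hom ≫ (θ 0).hom)
    (T.unitOf (map_zero (map0 F))).hom
  exact ⟨fun s => asIso (tw a (θ s).hom), by simpa using ha⟩

/-- The cochain `g` measures how far `θ` is from carrying the tensor constraint of `F` to the
isomorphisms of the sticks. Unitality of `F` makes it normalized; associativity and compatibility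
with the braiding give the two components of the equation. -/
theorem Stick.HasConstraints.comparison (F : A ⟶ B) {S : Stick A} {T : Stick B}
    {p : C3 (Pi0 A) (Pi1 A)} {q : C3 (Pi0 B) (Pi1 B)} (hp : S.HasConstraints p)
    (hq : T.HasConstraints q) :
    ∃ g ∈ C2 (Pi0 A) (Pi1 B), C3map (AddMonoidHom.id _) (map1 F) p =
      C3map (map0 F) (AddMonoidHom.id _) q + d2 _ _ g := by
  obtain ⟨θ, hθ⟩ := exists_comparison F S T
  have hg : ∀ s t : Pi0 A, ∃ a : Pi1 B, tw a ((θ s).hom ▷ _ ≫ _ ◁ (θ t).hom ≫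
      (T.i (map_add (map0 F) s t).symm).hom) =
      μ (toFun F) _ _ ≫ (toFun F).map (S.i (rfl : s + t = s + t)).hom ≫ (θ (s + t)).hom :=
    fun s t => exists_tw _ _
  choose g hg using hg
  have hg' : ∀ {s t r : Pi0 A} (h : s + t = r) (h' : map0 F s + map0 F t = map0 F r),
      μ (toFun F) _ _ ≫ (toFun F).map (S.i h).hom ≫ (θ r).hom =
      tw (g s t) ((θ s).hom ▷ _ ≫ _ ◁ (θ t).hom ≫ (T.i h').hom) := by
    rintro s t r rfl h'; exact (hg s t).symm
  clear hg
  have hθ' : (toFun F).map S.unit.inv ≫ η (toFun F) =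
      (θ 0).hom ≫ (T.unitOf (map_zero (map0 F))).inv := by
    rw [Iso.eq_comp_inv, ← hθ]; simp [← Functor.map_comp_assoc]
  refine ⟨g, ⟨fun s => ?_, fun s => ?_⟩, ?_⟩
  · have h := hg' (add_zero s) (by simp)
    rw [S.i_zero_right, T.i_right (map_zero _) _ rfl] at h
    apply tw_left_injective _ (h.symm.trans _)
    simp only [Functor.map_comp, map_whiskerLeft, map_rightUnitor, Category.assoc, μ_δ_assoc,
      eqToHom_refl, Category.comp_id, tw_zero]
    rw [← whiskerLeft_comp_assoc, hθ', ← whiskerLeft_comp_assoc _ (θ 0).hom,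
      ← whisker_exchange_assoc, rightUnitor_naturality]
  · have h := hg' (zero_add s) (by simp)
    rw [S.i_zero_left, T.i_left (map_zero _) _ rfl] at h
    apply tw_left_injective _ (h.symm.trans _)
    simp only [Functor.map_comp, map_whiskerRight, map_leftUnitor, Category.assoc, μ_δ_assoc,
      eqToHom_refl, Category.comp_id, tw_zero]
    rw [← comp_whiskerRight_assoc, hθ', ← whisker_exchange_assoc, ← comp_whiskerRight_assoc,
      whisker_exchange_assoc, leftUnitor_naturality]
  · ext s t r
    · change map1 F (p.1 s t r) = q.1 (map0 F s) (map0 F t) (map0 F r) +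
        (g t r - g (s + t) r + g s (t + r) - g s t)
      have f₁ : map0 F s + map0 F t = map0 F (s + t) := by simp
      have f₂ : map0 F t + map0 F r = map0 F (t + r) := by simp
      have f₃ : map0 F (s + t) + map0 F r = map0 F (s + t + r) := by simp
      have f₄ : map0 F s + map0 F (t + r) = map0 F (s + t + r) := by simp [add_assoc]
      have e₁ := hp.assoc' (rfl : s + t = s + t) rfl (rfl : t + r = t + r) (add_assoc s t r).symm
      have e₂ := hq.assoc' f₁ f₃ f₂ f₄
      have e₃ := hg' rfl f₁
      have e₄ := hg' rfl f₂
      have e₅ := hg' rfl f₃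
      have e₆ := hg' (add_assoc s t r).symm f₄
      have left : μ (toFun F) (S.rep s) (S.rep t) ▷ _ ≫ μ (toFun F) _ (S.rep r) ≫
          (toFun F).map (α_ _ _ _).hom ≫ (toFun F).map (S.rep s ◁ (S.i (rfl : t + r = t + r)).hom) ≫
          (toFun F).map (S.i (add_assoc s t r).symm).hom ≫ (θ (s + t + r)).hom =
          tw (map1 F (p.1 s t r) + g (s + t) r + g s t) ((θ s).hom ▷ _ ▷ _ ≫
            (_ ◁ (θ t).hom) ▷ _ ≫ _ ◁ (θ r).hom ≫ (T.i f₁).hom ▷ _ ≫ (T.i f₃).hom) := by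
        have e₃ := congrArg (· ▷ (toFun F).obj (S.rep r)) e₃
        simp only [comp_whiskerRight, tw_whiskerRight] at e₃
        rw [← Functor.map_comp_assoc, ← Functor.map_comp_assoc, Category.assoc, e₁, map_tw,
          Functor.map_comp]
        simp only [tw_comp, comp_tw, Category.assoc]
        rw [← μ_natural_left_assoc, e₅]
        simp only [comp_tw, tw_tw]
        rw [reassoc_of% e₃]
        simp only [tw_comp, Category.assoc, tw_tw]
        rw [whisker_exchange_assoc]
      have right : (α_ _ _ _).hom ≫ _ ◁ μ (toFun F) (S.rep t) (S.rep r) ≫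
          μ (toFun F) (S.rep s) _ ≫ (toFun F).map (S.rep s ◁ (S.i (rfl : t + r = t + r)).hom) ≫
          (toFun F).map (S.i (add_assoc s t r).symm).hom ≫ (θ (s + t + r)).hom =
          tw (g s (t + r) + g t r + q.1 (map0 F s) (map0 F t) (map0 F r)) ((θ s).hom ▷ _ ▷ _ ≫
            (_ ◁ (θ t).hom) ▷ _ ≫ _ ◁ (θ r).hom ≫ (T.i f₁).hom ▷ _ ≫ (T.i f₃).hom) := by
        have e₄ := congrArg (T.rep (map0 F s) ◁ ·) e₄
        simp only [whiskerLeft_comp, whiskerLeft_tw] at e₄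
        rw [← μ_natural_right_assoc, e₆]
        simp only [comp_tw]
        rw [whisker_exchange_assoc, whisker_exchange_assoc, reassoc_of% e₄]
        simp only [tw_comp, comp_tw, Category.assoc, tw_tw]
        rw [← associator_naturality_left_assoc, ← associator_naturality_middle_assoc,
          ← associator_naturality_right_assoc, e₂]
        simp only [comp_tw, tw_tw]
      rw [Functor.LaxMonoidal.associativity_assoc, right, tw_inj] at left
      rw [← sub_eq_zero] at left ⊢
      rw [← neg_eq_zero, ← left]; abel
    · change map1 F (p.2 s t) = q.2 (map0 F s) (map0 F t) + (g t s - g s t)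
      have e₁ := hp.braiding' (rfl : s + t = s + t) (add_comm t s)
      have e₂ := hq.braiding' (map_add (map0 F) s t).symm (by rw [← map_add, add_comm])
      have e₃ := hg' (rfl : s + t = s + t) (map_add (map0 F) s t).symm
      have e₄ := hg' (add_comm t s) (by rw [← map_add, add_comm])
      have left : (β_ _ _).hom ≫ μ (toFun F) (S.rep t) (S.rep s) ≫
          (toFun F).map (S.i (add_comm t s)).hom ≫ (θ (s + t)).hom =
          tw (map1 F (p.2 s t) + g s t) ((θ s).hom ▷ _ ≫ _ ◁ (θ t).hom ≫
            (T.i (map_add (map0 F) s t).symm).hom) := by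
        rw [← Functor.LaxBraided.braided_assoc, ← Functor.map_comp_assoc, e₁, map_tw, tw_comp,
          comp_tw, e₃, tw_tw]
      rw [e₄, comp_tw, ← BraidedCategory.braiding_naturality_right_assoc,
        ← BraidedCategory.braiding_naturality_left_assoc, e₂] at left
      simp only [comp_tw, tw_tw] at left
      rw [whisker_exchange_assoc, tw_inj] at left
      rw [← sub_eq_zero] at left ⊢
      rw [← neg_eq_zero, ← left]; abel

/-- Comparison along the identity functor shows that two sticks give cohomologous cocycles. -/
theorem exists_isClassOf (B : BCG.{v, u}) : ∃ c, IsClassOf B c := by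
  obtain ⟨S⟩ := Stick.nonempty B
  obtain ⟨p, hp⟩ := S.exists_hasConstraints
  refine ⟨(QuotientAddGroup.mk ⟨p, hp.isAbelianCocycle⟩ : H3ab _ _), ⟨S⟩, fun T => ?_⟩
  obtain ⟨q, hq⟩ := T.exists_hasConstraints
  refine ⟨⟨q, hq.isAbelianCocycle⟩, hq, QuotientAddGroup.eq.2 ?_⟩
  obtain ⟨g, hg, h⟩ := Stick.HasConstraints.comparison (𝟙 B) hp hq
  rw [map0_id, map1_id] at h
  exact ⟨g, hg, by
    change d2 _ _ g = -q + p
    rw [eq_neg_add_iff_add_eq]; exact h.symm⟩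

/-- The class of `𝔹` in `H³_ab(π₀ 𝔹, π₁ 𝔹)`. -/
noncomputable def cls (B : BCG.{v, u}) : H3ab (Pi0 B) (Pi1 B) := (exists_isClassOf B).choose

theorem isClassOf_cls (B : BCG.{v, u}) : IsClassOf B (cls B) := (exists_isClassOf B).choose_spec

/-- Injectivity of `gam` makes the pair `(h, η)` of a given stick unique, so the class can be
computed from any stick at hand. -/
theorem Stick.HasConstraints.cls_eq {S : Stick B} {p : C3 (Pi0 B) (Pi1 B)}
    (hp : S.HasConstraints p) :
    cls B = QuotientAddGroup.mk ⟨p, hp.isAbelianCocycle⟩ := by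
  obtain ⟨z, hz, h⟩ := (isClassOf_cls B).2 S
  rw [← h]
  congr 1
  apply Subtype.ext
  refine Prod.ext ?_ ?_
  · funext s t r
    exact gam_injective _ ((cancel_epi _).1 ((cancel_epi _).1
      ((hz.assoc s t r).trans (hp.assoc s t r).symm)))
  · funext s t
    exact gam_injective _ ((cancel_epi _).1 ((hz.braiding s t).trans (hp.braiding s t).symm))

theorem pull_cls_eq_push_cls (A B : BCG.{v, u}) (F : A ⟶ B) :
    H3pull (Pi1 B) (map0 F) (cls B) = H3push (Pi0 A) (map1 F) (cls A) := by
  obtain ⟨S⟩ := Stick.nonempty A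
  obtain ⟨p, hp⟩ := S.exists_hasConstraints
  obtain ⟨T⟩ := Stick.nonempty B
  obtain ⟨q, hq⟩ := T.exists_hasConstraints
  rw [hp.cls_eq, hq.cls_eq]
  obtain ⟨g, hg, h⟩ := Stick.HasConstraints.comparison F hp hq
  refine QuotientAddGroup.eq.2 ⟨g, hg, ?_⟩
  change d2 _ _ g = -C3map (map0 F) (AddMonoidHom.id _) q + C3map (AddMonoidHom.id _) (map1 F) p
  rw [h, neg_add_cancel_left]

end Comparison

/-! ### Equivalences and isomorphisms of invariants -/

section Equivalences

variable {A B : BCG.{v, u}}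

theorem Homotopic.map0_eq {F G : A ⟶ B} (h : Homotopic F G) : map0 F = map0 G := by
  obtain ⟨α, _⟩ := h
  ext s
  induction s using Quotient.inductionOn with | _ X
  exact Pi0.sound (α.app X)

theorem Homotopic.map1_eq {F G : A ⟶ B} (h : Homotopic F G) : map1 F = map1 G := by
  obtain ⟨α, hα⟩ := h
  ext a
  apply Iso.ext
  change ε (toFun F) ≫ (toFun F).map a.aut.hom ≫ η (toFun F) =
    ε (toFun G) ≫ (toFun G).map a.aut.hom ≫ η (toFun G)
  have h₁ : ε (toFun F) ≫ α.hom.app _ = ε (toFun G) := hα.unit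
  have h₂ : η (toFun F) = α.hom.app _ ≫ η (toFun G) := by
    rw [← cancel_mono (ε (toFun G)), Category.assoc, η_ε, ← h₁, η_ε_assoc, Category.comp_id]
  rw [h₂, α.hom.naturality_assoc, reassoc_of% h₁]

/-- The functor of `e` is faithful, and monoidality of the counit reduces the claim to naturality of
the braiding and braidedness of `e.functor`. -/
theorem map_braiding_inverse {C D : Type*} [Category* C] [Category* D] [MonoidalCategory C]
    [MonoidalCategory D] [BraidedCategory C] [BraidedCategory D] (e : C ≌ D) [e.functor.Braided]
    [e.inverse.Monoidal] [e.IsMonoidal] (X Y : D) :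
    μ e.inverse X Y ≫ e.inverse.map (β_ X Y).hom =
      (β_ (e.inverse.obj X) (e.inverse.obj Y)).hom ≫ μ e.inverse Y X := by
  apply e.functor.map_injective
  have h : e.functor.map (e.inverse.map (β_ X Y).hom) ≫ e.counitIso.hom.app (Y ⊗ X) =
    e.counitIso.hom.app (X ⊗ Y) ≫ (β_ X Y).hom := e.counitIso.hom.naturality _
  rw [← cancel_mono (e.counitIso.hom.app _), Functor.map_comp, Category.assoc, h,
    e.functor_map_μ_inverse_comp_counitIso_hom_app_tensor_assoc, Functor.map_comp, Category.assoc,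
    e.functor_map_μ_inverse_comp_counitIso_hom_app_tensor]
  simp

theorem isBraidedEquivalence_mk (e : A ≌ B) [e.functor.Braided] [e.inverse.Braided]
    [e.IsMonoidal] : IsBraidedEquivalence (⟨e.functor⟩ : A ⟶ B) := by
  refine ⟨⟨e.inverse⟩, ⟨e.unitIso.symm, ?_⟩, ⟨e.counitIso, ?_⟩⟩
  · have h : NatTrans.IsMonoidal e.unitIso.hom := inferInstanceAs (NatTrans.IsMonoidal e.unit)
    exact inferInstanceAs (NatTrans.IsMonoidal e.unitIso.inv)
  · exact inferInstanceAs (NatTrans.IsMonoidal e.counit)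

theorem isBraidedEquivalence_of_isMonoidal (e : A ≌ B) [e.functor.Braided] [e.inverse.Monoidal]
    [e.IsMonoidal] : IsBraidedEquivalence (⟨e.functor⟩ : A ⟶ B) :=
  @isBraidedEquivalence_mk _ _ e _ { braided := map_braiding_inverse e } ‹_›

/-- The structure on the inverse is the one transferred to a right adjoint along the adjunction, for
which unit and counit are monoidal. -/
theorem inverseMonoidal_isMonoidal {C D : Type*} [Category* C] [Category* D] [MonoidalCategory C]
    [MonoidalCategory D] (e : C ≌ D) [e.functor.Monoidal] :
    @Equivalence.IsMonoidal _ _ _ _ _ _ e _ e.inverseMonoidal :=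
  (inferInstance : letI := e.toAdjunction.rightAdjointLaxMonoidal; e.toAdjunction.IsMonoidal)

theorem isBraidedEquivalence_of_isEquivalence (F : A ⟶ B) [(toFun F).IsEquivalence] :
    IsBraidedEquivalence F := by
  let : (toFun F).asEquivalence.functor.Braided := F.braided
  exact @isBraidedEquivalence_of_isMonoidal _ _ (toFun F).asEquivalence _
    (toFun F).asEquivalence.inverseMonoidal (inverseMonoidal_isMonoidal _)

/-- On nonempty hom-sets `F` is a map of torsors over `F₁`, hence bijective. Injectivity of `F₀`
ensures that a hom-set is nonempty when its target is, and surjectivity of `F₀` is essential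
surjectivity. -/
theorem isEquivalence_of_bijective (F : A ⟶ B) (h₀ : Function.Bijective (map0 F))
    (h₁ : Function.Bijective (map1 F)) : (toFun F).IsEquivalence where
  faithful := ⟨fun {X Y f g} h => by
    obtain ⟨a, rfl⟩ := exists_tw f g
    rw [map_tw] at h
    nth_rw 1 [← tw_zero ((toFun F).map f)] at h
    rw [tw_inj, ← map_zero (map1 F)] at h
    rw [← h₁.1 h, tw_zero]⟩
  full := ⟨fun {X Y f} => by
    obtain ⟨e⟩ : Nonempty (X ≅ Y) := Pi0.iso_of_eq (h₀.1 (Pi0.sound (asIso f)))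
    obtain ⟨a, rfl⟩ := exists_tw ((toFun F).map e.hom) f
    obtain ⟨b, rfl⟩ := h₁.2 a
    exact ⟨tw b e.hom, map_tw _ _ _⟩⟩
  essSurj := ⟨fun Y => by
    obtain ⟨s, hs⟩ := h₀.2 (Pi0.mk Y)
    induction s using Quotient.inductionOn with | _ X
    exact ⟨X, Pi0.iso_of_eq hs⟩⟩

theorem H3BGr.bijective_of_isIso {P Q : H3BGr.{v, u}} (p : P ⟶ Q) [IsIso p] :
    Function.Bijective p.φ ∧ Function.Bijective p.f := by
  have h₁ := IsIso.hom_inv_id p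
  have h₂ := IsIso.inv_hom_id p
  have a₁ := fun x => DFunLike.congr_fun (congrArg H3BGr.Hom.φ h₁) x
  have a₂ := fun x => DFunLike.congr_fun (congrArg H3BGr.Hom.φ h₂) x
  have b₁ := fun x => DFunLike.congr_fun (congrArg H3BGr.Hom.f h₁) x
  have b₂ := fun x => DFunLike.congr_fun (congrArg H3BGr.Hom.f h₂) x
  exact ⟨Function.bijective_iff_has_inverse.2 ⟨(inv p).φ, a₁, a₂⟩,
    Function.bijective_iff_has_inverse.2 ⟨(inv p).f, b₁, b₂⟩⟩

/-- The functor `𝔹 ↦ (π₀ 𝔹, π₁ 𝔹, [(h, η)_𝔹])`. -/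
noncomputable abbrev classify : BCG.{v, u} ⥤ H3BGr.{v, u} :=
  classifyingFunctor cls pull_cls_eq_push_cls

theorem classify_map_eq_iff {F G : A ⟶ B} :
    classify.map F = classify.map G ↔ map0 F = map0 G ∧ map1 F = map1 G :=
  ⟨fun h => ⟨congrArg H3BGr.Hom.φ h, congrArg H3BGr.Hom.f h⟩, fun h => H3BGr.Hom.ext h.1 h.2⟩

theorem Homotopic.classify_map_eq {F G : A ⟶ B} (h : Homotopic F G) :
    classify.map F = classify.map G := classify_map_eq_iff.2 ⟨h.map0_eq, h.map1_eq⟩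

theorem isIso_classify_map_of_isBraidedEquivalence {F : A ⟶ B} (h : IsBraidedEquivalence F) :
    IsIso (classify.map F) := by
  obtain ⟨G, h₁, h₂⟩ := h
  have h₁ := h₁.classify_map_eq
  have h₂ := h₂.classify_map_eq
  rw [CategoryTheory.Functor.map_comp, CategoryTheory.Functor.map_id] at h₁ h₂
  exact ⟨classify.map G, h₁, h₂⟩

theorem isEquivalence_of_isIso_classify_map (F : A ⟶ B) [IsIso (classify.map F)] :
    (toFun F).IsEquivalence :=
  have h := H3BGr.bijective_of_isIso (classify.map F)
  isEquivalence_of_bijective F h.1 h.2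

theorem isIso_classify_map_iff_isBraidedEquivalence (F : A ⟶ B) :
    IsIso (classify.map F) ↔ IsBraidedEquivalence F :=
  ⟨fun _ => have := isEquivalence_of_isIso_classify_map F
    isBraidedEquivalence_of_isEquivalence F, isIso_classify_map_of_isBraidedEquivalence⟩

theorem isIso_classify_map_iff_isEquivalence (F : A ⟶ B) :
    IsIso (classify.map F) ↔ (toFun F).IsEquivalence :=
  ⟨fun _ => isEquivalence_of_isIso_classify_map F, fun _ =>
    isIso_classify_map_of_isBraidedEquivalence (isBraidedEquivalence_of_isEquivalence F)⟩

end Equivalences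

/-! ### Realization of a cocycle by a reduced category -/

section Reduced

variable {M : Type u} {N : Type v} [AddCommGroup M] [AddCommGroup N]

/-- The objects of the reduced braided Gr-category of an abelian 3-cocycle `z` of `M` with
coefficients in `N`: the elements of `M`. -/
structure Red (_ : Z3ab M N) : Type u where
  val : M

namespace Red

variable (z : Z3ab M N)

/-- The predicate of the subtype does not involve the element of `N`. A hom-set is thus a copy of
`N` or empty, and equations of morphisms are checked in `N` without transport. -/
instance : Category.{v} (Red z) where
  Hom s t := {_n : N // s.val = t.val}
  id _ := ⟨0, rfl⟩
  comp f g := ⟨f.1 + g.1, f.2.trans g.2⟩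
  id_comp f := Subtype.ext (zero_add f.1)
  comp_id f := Subtype.ext (add_zero f.1)
  assoc f g h := Subtype.ext (add_assoc f.1 g.1 h.1)

variable {z}

@[ext] theorem hom_ext {s t : Red z} {f g : s ⟶ t} (h : f.1 = g.1) : f = g := Subtype.ext h

@[simp] theorem id_val (s : Red z) : (𝟙 s : s ⟶ s).1 = 0 := rfl

@[simp] theorem comp_val {s t r : Red z} (f : s ⟶ t) (g : t ⟶ r) : (f ≫ g).1 = f.1 + g.1 := rfl

/-- The isomorphism of `Red z` given by an element of `N`. -/
def iso {s t : Red z} (n : N) (h : s.val = t.val) : s ≅ t where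
  hom := ⟨n, h⟩
  inv := ⟨-n, h.symm⟩
  hom_inv_id := hom_ext (add_neg_cancel n)
  inv_hom_id := hom_ext (neg_add_cancel n)

instance : IsGroupoid (Red z) where
  all_isIso f := (iso f.1 f.2).isIso_hom

/-- The pentagon is the cocycle identity and the triangle is the middle normalization. -/
instance : MonoidalCategory (Red z) where
  tensorObj s t := ⟨s.val + t.val⟩
  tensorUnit := ⟨0⟩
  whiskerLeft s t t' f := ⟨f.1, congrArg (s.val + ·) f.2⟩
  whiskerRight f t := ⟨f.1, congrArg (· + t.val) f.2⟩
  tensorHom f g := ⟨f.1 + g.1, congrArg₂ (· + ·) f.2 g.2⟩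
  associator s t r := iso (z.1.1 s.val t.val r.val) (add_assoc _ _ _)
  leftUnitor s := iso 0 (zero_add _)
  rightUnitor s := iso 0 (add_zero _)
  tensorHom_def f g := hom_ext rfl
  id_tensorHom_id s t := hom_ext (add_zero _)
  tensorHom_comp_tensorHom f g f' g' := hom_ext (add_add_add_comm _ _ _ _)
  whiskerLeft_id s t := rfl
  id_whiskerRight s t := rfl
  associator_naturality {s t r s' t' r'} f g h := by
    apply hom_ext
    have e : z.1.1 s'.val t'.val r'.val = z.1.1 s.val t.val r.val := by rw [f.2, g.2, h.2]
    change f.1 + g.1 + h.1 + z.1.1 s'.val t'.val r'.val =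
      z.1.1 s.val t.val r.val + (f.1 + (g.1 + h.1))
    rw [e]; abel
  leftUnitor_naturality f := hom_ext (add_comm f.1 0)
  rightUnitor_naturality f := hom_ext (add_comm f.1 0)
  pentagon s t r q := by
    apply hom_ext
    have h := z.2.cocycle s.val t.val r.val q.val
    change z.1.1 s.val t.val r.val + (z.1.1 s.val (t.val + r.val) q.val +
      z.1.1 t.val r.val q.val) =
      z.1.1 (s.val + t.val) r.val q.val + z.1.1 s.val t.val (r.val + q.val)
    rw [← sub_eq_zero, ← h]; abel
  triangle s t := by
    apply hom_ext
    change z.1.1 s.val 0 t.val + 0 = 0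
    rw [z.2.norm₂, add_zero]

instance : BraidedCategory (Red z) where
  braiding s t := iso (z.1.2 s.val t.val) (add_comm _ _)
  braiding_naturality_right s t t' f := by
    apply hom_ext
    have e : z.1.2 s.val t'.val = z.1.2 s.val t.val := by rw [f.2]
    change f.1 + z.1.2 s.val t'.val = z.1.2 s.val t.val + f.1
    rw [e, add_comm]
  braiding_naturality_left {s s'} f t := by
    apply hom_ext
    have e : z.1.2 s'.val t.val = z.1.2 s.val t.val := by rw [f.2]
    change f.1 + z.1.2 s'.val t.val = z.1.2 s.val t.val + f.1
    rw [e, add_comm]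
  hexagon_forward s t r := by
    apply hom_ext
    have h := z.2.hexagon₁ s.val t.val r.val
    change z.1.1 s.val t.val r.val + (z.1.2 s.val (t.val + r.val) + z.1.1 t.val r.val s.val) =
      z.1.2 s.val t.val + (z.1.1 t.val s.val r.val + z.1.2 s.val r.val)
    rw [← sub_eq_zero, ← h]; abel
  hexagon_reverse s t r := by
    apply hom_ext
    have h := z.2.hexagon₂ s.val t.val r.val
    change -z.1.1 s.val t.val r.val + (z.1.2 (s.val + t.val) r.val + -z.1.1 r.val s.val t.val) =
      z.1.2 t.val r.val + (-z.1.1 s.val r.val t.val + z.1.2 s.val r.val)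
    rw [← sub_eq_zero, ← neg_eq_zero, ← h]; abel

end Red

/-- The reduced braided Gr-category of an abelian 3-cocycle. -/
def reduced (z : Z3ab M N) : BCG.{v, u} where
  carrier := Red z
  invertible s := ⟨⟨-s.val⟩, ⟨Red.iso 0 (neg_add_cancel s.val)⟩⟩

variable (z : Z3ab M N)

theorem gam_reduced_val (s : Red z) (a : Pi1 (reduced z)) :
    Subtype.val (gam (B := reduced z) s a) = a.aut.hom.1 := by
  change -0 + (a.aut.hom.1 + 0) = a.aut.hom.1
  simp

/-- `π₀` of the reduced braided Gr-category of a cocycle of `M` is `M`. -/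
def reducedPi0 : Pi0 (reduced z) ≃+ M where
  toFun := Quotient.lift (fun s : Red z => s.val) fun _ _ ⟨e⟩ => e.hom.2
  invFun s := Pi0.mk (B := reduced z) (⟨s⟩ : Red z)
  left_inv s := by induction s using Quotient.inductionOn with | _ s => rfl
  right_inv _ := rfl
  map_add' s t := by
    induction s using Quotient.inductionOn with | _ s
    induction t using Quotient.inductionOn with | _ t
    rfl

/-- `π₁` of the reduced braided Gr-category of a cocycle with coefficients in `N` is `N`. -/
def reducedPi1 : Pi1 (reduced z) ≃+ N where
  toFun a := a.aut.hom.1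
  invFun n := (Red.iso n rfl : 𝟙_ (Red z) ≅ 𝟙_ (Red z))
  left_inv _ := Iso.ext (Red.hom_ext rfl)
  right_inv _ := rfl
  map_add' _ _ := rfl

/-- The stick of the reduced braided Gr-category whose isomorphisms are identities. -/
noncomputable def reducedStick : Stick (reduced z) where
  rep s := (⟨reducedPi0 z s⟩ : Red z)
  rep_mem := (reducedPi0 z).symm_apply_apply
  unit := Red.iso 0 (map_zero (reducedPi0 z)).symm
  i {s t r} h := Red.iso 0 (h ▸ ((reducedPi0 z).map_add s t).symm)
  i_zero_left t := Red.hom_ext (by change (0 : N) = -0 + 0; simp)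
  i_zero_right t := Red.hom_ext (by change (0 : N) = -0 + 0; simp)

/-- All isomorphisms of the stick are zero in `N`, so the constraints of the stick are those of the
category. -/
theorem reducedStick_hasConstraints : (reducedStick z).HasConstraints
    (C3map (reducedPi0 z : _ →+ M) ((reducedPi1 z).symm : N →+ _) z.1) where
  assoc s t r := Red.hom_ext (by
    change (0 : N) + (0 + Subtype.val (gam (B := reduced z) _ _)) = z.1.1 _ _ _ + (0 + 0)
    simp only [zero_add, add_zero]
    exact gam_reduced_val z _ _)
  braiding s t := Red.hom_ext (by
    change (0 : N) + Subtype.val (gam (B := reduced z) _ _) = z.1.2 _ _ + 0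
    simp only [zero_add, add_zero]
    exact gam_reduced_val z _ _)

/-- Every object of `H³_BGr` is the invariant of a reduced braided Gr-category. -/
noncomputable def classifyReducedIso :
    classify.obj (reduced z) ≅ ⟨M, N, (QuotientAddGroup.mk z : H3ab M N)⟩ where
  hom := ⟨(reducedPi0 z).toAddMonoidHom, (reducedPi1 z).toAddMonoidHom, by
    change _ = H3push _ _ (cls _)
    rw [(reducedStick_hasConstraints z).cls_eq]
    rfl⟩
  inv := ⟨(reducedPi0 z).symm.toAddMonoidHom, (reducedPi1 z).symm.toAddMonoidHom, by
    change H3pull _ _ (cls _) = _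
    rw [(reducedStick_hasConstraints z).cls_eq]
    rfl⟩
  hom_inv_id := H3BGr.Hom.ext (AddMonoidHom.ext (reducedPi0 z).symm_apply_apply)
    (AddMonoidHom.ext (reducedPi1 z).symm_apply_apply)
  inv_hom_id := H3BGr.Hom.ext (AddMonoidHom.ext (reducedPi0 z).apply_symm_apply)
    (AddMonoidHom.ext (reducedPi1 z).apply_symm_apply)

theorem classify_essSurj : (classify.{v, u}).EssSurj where
  mem_essImage P := by
    obtain ⟨M, N, c⟩ := P
    obtain ⟨z, rfl⟩ := QuotientAddGroup.mk_surjective c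
    exact ⟨reduced z, ⟨classifyReducedIso z⟩⟩

end Reduced

/-- A braided lax monoidal functor between braided Gr-categories is a braided Gr-functor. -/
noncomputable def homOfLaxBraided {A B : BCG.{v, u}} (F : A ⥤ B) [F.LaxBraided] : A ⟶ B :=
  BCG.Hom.mk F (braided := { toMonoidal := .ofLaxMonoidal F, braided := Functor.LaxBraided.braided })

/-! ### Functors out of a reduced category; fullness -/

section ReducedFunctor

variable {M : Type u} {N : Type v} [AddCommGroup M] [AddCommGroup N] {z : Z3ab M N}
  {B : BCG.{v, u}} (T : Stick B) (φ : M →+ Pi0 B) (f : N →+ Pi1 B)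

/-- The functor from a reduced braided Gr-category to `𝔹` which is given by a stick of `𝔹` and
a pair of homomorphisms. -/
noncomputable def reducedFunctor (z : Z3ab M N) : Red z ⥤ B where
  obj s := T.rep (φ s.val)
  map {s t} n := tw (f n.1) (eqToHom (congrArg (fun x : M => T.rep (φ x)) n.2))
  map_id s := by simp
  map_comp a b := by simp [add_comm]

/-- `reducedFunctor` is braided monoidal with constraints given by a cochain `g` whose coboundary
is the difference of the cocycles. -/
@[reducible] noncomputable def reducedFunctorLaxBraided {q : C3 (Pi0 B) (Pi1 B)}
    (hq : T.HasConstraints q)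
    {g : M → M → Pi1 B} (hg : g ∈ C2 M (Pi1 B))
    (h : C3map (AddMonoidHom.id M) f z.1 = C3map φ (AddMonoidHom.id _) q + d2 _ _ g) :
    (reducedFunctor T φ f z).LaxBraided where
  ε := (T.unitOf (map_zero φ)).hom
  μ s t := tw (g s.val t.val) (T.i (map_add φ s.val t.val).symm).hom
  μ_natural_left := by
    rintro ⟨s⟩ ⟨s'⟩ ⟨n, h⟩ ⟨t⟩
    obtain rfl : s = s' := h
    change tw (f n) (𝟙 _) ▷ T.rep (φ t) ≫ tw (g s t) _ = tw (g s t) _ ≫ tw (f n) (𝟙 _)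
    simp
  μ_natural_right := by
    rintro ⟨s⟩ ⟨s'⟩ ⟨t⟩ ⟨n, h⟩
    obtain rfl : s = s' := h
    change T.rep (φ t) ◁ tw (f n) (𝟙 _) ≫ tw (g t s) _ = tw (g t s) _ ≫ tw (f n) (𝟙 _)
    simp
  associativity := by
    rintro ⟨s⟩ ⟨t⟩ ⟨r⟩
    change tw (g s t) (T.i _).hom ▷ T.rep (φ r) ≫ tw (g (s + t) r) (T.i _).hom ≫
      tw (f (z.1.1 s t r)) (eqToHom _) = (α_ (T.rep (φ s)) (T.rep (φ t)) (T.rep (φ r))).hom ≫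
        T.rep (φ s) ◁ tw (g t r) (T.i _).hom ≫ tw (g s (t + r)) (T.i _).hom
    have e := hq.assoc' (map_add φ s t).symm (by rw [← map_add, add_assoc]) (map_add φ t r).symm
      (map_add φ s (t + r)).symm
    have h₁ : f (z.1.1 s t r) = q.1 (φ s) (φ t) (φ r) +
        (g t r - g (s + t) r + g s (t + r) - g s t) :=
      congrFun (congrFun (congrFun (congrArg Prod.fst h) s) t) r
    simp only [tw_whiskerRight, whiskerLeft_tw, tw_comp, comp_tw, tw_tw]
    rw [e, tw_tw, T.i_eqToHom _ (congrArg φ (add_assoc s t r)), tw_inj, h₁]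
    abel
  left_unitality := by
    rintro ⟨s⟩
    change (λ_ (T.rep (φ s))).hom = (T.unitOf (map_zero φ)).hom ▷ T.rep (φ s) ≫
      tw (g 0 s) (T.i _).hom ≫ tw (f 0) (eqToHom _)
    rw [hg.2, map_zero f, tw_zero, tw_zero, T.i_eqToHom _ (congrArg φ (zero_add s)),
      T.i_left (map_zero φ) _ rfl]
    simp
  right_unitality := by
    rintro ⟨s⟩
    change (ρ_ (T.rep (φ s))).hom = T.rep (φ s) ◁ (T.unitOf (map_zero φ)).hom ≫
      tw (g s 0) (T.i _).hom ≫ tw (f 0) (eqToHom _)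
    rw [hg.1, map_zero f, tw_zero, tw_zero, T.i_eqToHom _ (congrArg φ (add_zero s)),
      T.i_right (map_zero φ) _ rfl]
    simp
  braided := by
    rintro ⟨s⟩ ⟨t⟩
    change tw (g s t) (T.i _).hom ≫ tw (f (z.1.2 s t)) (eqToHom _) =
      (β_ (T.rep (φ s)) (T.rep (φ t))).hom ≫ tw (g t s) (T.i _).hom
    have h₁ : f (z.1.2 s t) = q.2 (φ s) (φ t) + (g t s - g s t) :=
      congrFun (congrFun (congrArg Prod.snd h) s) t
    have e := hq.braiding' (by rw [← map_add, add_comm]) (map_add φ t s).symm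
    simp only [tw_comp, comp_tw, tw_tw]
    rw [e, tw_tw, T.i_eqToHom _ (congrArg φ (add_comm s t)), tw_inj, h₁]
    abel

theorem map1_reducedFunctor {q : C3 (Pi0 B) (Pi1 B)} (hq : T.HasConstraints q)
    {g : M → M → Pi1 B} (hg : g ∈ C2 M (Pi1 B))
    (h : C3map (AddMonoidHom.id M) f z.1 = C3map φ (AddMonoidHom.id _) q + d2 _ _ g) (n : N) :
    map1 (@homOfLaxBraided (reduced z) B _ (reducedFunctorLaxBraided T φ f hq hg h))
      ((reducedPi1 z).symm n) = f n := by
  apply Iso.ext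
  change (T.unitOf (map_zero φ)).hom ≫ tw (f n) (𝟙 _) ≫ inv (T.unitOf (map_zero φ)).hom =
    (f n).aut.hom
  simp only [comp_tw, tw_comp, Category.id_comp, IsIso.hom_inv_id]
  rw [← gam_eq_tw, gam_unit]

/-- Equality of classes yields a cochain `g` with `f_* z = φ^* q + ∂_ab g`, exactly what is needed
for `g` to serve as a tensor constraint. -/
theorem exists_hom_of_reduced (p : classify.obj (reduced z) ⟶ classify.obj B) :
    ∃ F : reduced z ⟶ B, classify.map F = p := by
  obtain ⟨T⟩ := Stick.nonempty B
  obtain ⟨q, hq⟩ := T.exists_hasConstraints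
  -- Passing through this isomorphism gives homomorphisms defined on `M` and `N` themselves.
  let p' := (classifyReducedIso z).inv ≫ p
  have h := p'.compat
  change H3pull _ _ (cls B) = _ at h
  rw [hq.cls_eq] at h
  obtain ⟨g, hg, h⟩ := QuotientAddGroup.eq.1 h
  let L := reducedFunctorLaxBraided T p'.φ p'.f hq hg (z := z) (by
    rw [h]; exact (add_neg_cancel_left _ _).symm)
  refine ⟨@homOfLaxBraided (reduced z) B (reducedFunctor T p'.φ p'.f z) L, ?_⟩
  rw [← cancel_epi (classifyReducedIso z).inv]
  refine H3BGr.Hom.ext (AddMonoidHom.ext fun s => T.rep_mem _) (AddMonoidHom.ext fun n => ?_)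
  exact map1_reducedFunctor T p'.φ p'.f hq hg _ n

end ReducedFunctor

/-- The source is replaced by the reduced category of its own cocycle: the isomorphism `e` of
invariants lifts to a functor `F`, which is an equivalence because its image is invertible. If `G`
lifts `e` followed by `p`, then `G` precomposed with the inverse of `F` lifts `p`. -/
theorem classify_full : (classify.{v, u}).Full where
  map_surjective {A B} p := by
    obtain ⟨S⟩ := Stick.nonempty A
    obtain ⟨w, hw⟩ := S.exists_hasConstraints
    let z : Z3ab (Pi0 A) (Pi1 A) := ⟨w, hw.isAbelianCocycle⟩
    have e : classify.obj (reduced z) ≅ classify.obj A :=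
      classifyReducedIso z ≪≫ eqToIso (congrArg (H3BGr.mk (Pi0 A) (Pi1 A)) hw.cls_eq.symm)
    obtain ⟨F, hF⟩ := exists_hom_of_reduced e.hom
    obtain ⟨G, hG⟩ := exists_hom_of_reduced (e.hom ≫ p)
    have : IsIso (classify.map F) := hF ▸ inferInstance
    obtain ⟨F', -, h⟩ := (isIso_classify_map_iff_isBraidedEquivalence F).1 this
    refine ⟨F' ≫ G, ?_⟩
    have h := h.classify_map_eq
    rw [CategoryTheory.Functor.map_comp, CategoryTheory.Functor.map_id, hF] at h
    rw [CategoryTheory.Functor.map_comp, hG, reassoc_of% h]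

/-! ### Homotopy classes as a torsor under `H²_ab` -/

section Twist

variable {A B : BCG.{v, u}}

theorem Z2ab_symm {M : Type u} {N : Type v} [AddCommGroup M] [AddCommGroup N] {g : M → M → N}
    (hg : g ∈ Z2ab M N) (x y : M) : g y x = g x y :=
  sub_eq_zero.1 (congrFun (congrFun (congrArg Prod.snd hg.2) x) y)

theorem Z2ab_cocycle {M : Type u} {N : Type v} [AddCommGroup M] [AddCommGroup N] {g : M → M → N}
    (hg : g ∈ Z2ab M N) (x y z : M) : g y z + g x (y + z) = g x y + g (x + y) z := by
  have h : g y z - g (x + y) z + g x (y + z) - g x y = 0 :=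
    congrFun (congrFun (congrFun (congrArg Prod.fst hg.2) x) y) z
  rw [← sub_eq_zero, ← h]; abel

theorem mem_Z2ab {M : Type u} {N : Type v} [AddCommGroup M] [AddCommGroup N] {g : M → M → N}
    (h₁ : ∀ x, g x 0 = 0) (h₂ : ∀ y, g 0 y = 0) (hs : ∀ x y, g y x = g x y)
    (hc : ∀ x y z, g y z + g x (y + z) = g x y + g (x + y) z) : g ∈ Z2ab M N := by
  refine ⟨⟨h₁, h₂⟩, Prod.ext ?_ ?_⟩
  · funext x y z
    change g y z - g (x + y) z + g x (y + z) - g x y = 0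
    have h := sub_eq_zero.2 (hc x y z)
    rw [← h]; abel
  · funext x y
    exact sub_eq_zero.2 (hs x y)

/-- The tensor constraint of `F` modified by a symmetric 2-cocycle. -/
@[reducible] def twistLaxBraided (F : A ⟶ B) {g : Pi0 A → Pi0 A → Pi1 B}
    (hg : g ∈ Z2ab (Pi0 A) (Pi1 B)) : (toFun F).LaxBraided where
  ε := ε (toFun F)
  μ X Y := tw (g (Pi0.mk X) (Pi0.mk Y)) (μ (toFun F) X Y)
  μ_natural_left f Z := by
    rw [Pi0.sound (asIso f)]; simp
  μ_natural_right Z f := by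
    rw [Pi0.sound (asIso f)]; simp
  associativity X Y Z := by
    simp [Pi0.mk_tensor, Z2ab_cocycle hg, add_comm]
  left_unitality X := by
    rw [show g (Pi0.mk (𝟙_ A)) _ = 0 from hg.1.2 _]; simp
  right_unitality X := by
    rw [show g _ (Pi0.mk (𝟙_ A)) = 0 from hg.1.1 _]; simp
  braided X Y := by
    rw [tw_comp, comp_tw, Functor.LaxBraided.braided, Z2ab_symm hg]

/-- The braided Gr-functor obtained from `F` by modifying its tensor constraint by a symmetric
2-cocycle. -/
noncomputable def twist (F : A ⟶ B) (g : Z2ab (Pi0 A) (Pi1 B)) : A ⟶ B :=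
  @homOfLaxBraided A B (toFun F) (twistLaxBraided F g.2)

theorem map0_twist (F : A ⟶ B) (g : Z2ab (Pi0 A) (Pi1 B)) : map0 (twist F g) = map0 F := rfl

theorem map1_twist (F : A ⟶ B) (g : Z2ab (Pi0 A) (Pi1 B)) : map1 (twist F g) = map1 F := by
  ext a
  apply Iso.ext
  change ε (toFun F) ≫ (toFun F).map a.aut.hom ≫ inv (ε (toFun F)) =
    ε (toFun F) ≫ (toFun F).map a.aut.hom ≫ η (toFun F)
  simp [IsIso.inv_eq_of_hom_inv_id (ε_η (toFun F))]

theorem homotopic_twist_iff_exists (F G : A ⟶ B) (g : Z2ab (Pi0 A) (Pi1 B)) :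
    Homotopic (twist F g) G ↔ ∃ α : toFun F ≅ toFun G,
      ε (toFun F) ≫ α.hom.app (𝟙_ A) = ε (toFun G) ∧
      ∀ X Y, tw (g.1 (Pi0.mk X) (Pi0.mk Y)) (μ (toFun F) X Y) ≫ α.hom.app (X ⊗ Y) =
        (α.hom.app X ⊗ₘ α.hom.app Y) ≫ μ (toFun G) X Y :=
  ⟨fun ⟨α, h⟩ => ⟨α, h.unit, h.tensor⟩, fun ⟨α, h₁, h₂⟩ => ⟨α, ⟨h₁, h₂⟩⟩⟩

/-- A natural automorphism of `F` is the same as a function `t` on `π₀`: its components are twists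
of identities, and naturality makes them depend only on the isomorphism class. The unit condition
says `t 0 = 0`, the tensor condition says `g - g' = ∂ t`. -/
theorem homotopic_twist_twist_iff (F : A ⟶ B) (g g' : Z2ab (Pi0 A) (Pi1 B)) :
    Homotopic (twist F g) (twist F g') ↔ g.1 - g'.1 ∈ B2ab (Pi0 A) (Pi1 B) := by
  rw [homotopic_twist_iff_exists]
  constructor
  · rintro ⟨(α : toFun F ≅ toFun F), h₁, h₂⟩
    have h : ∀ X : A, ∃ a : Pi1 B, tw a (𝟙 _) = α.hom.app X := fun X => exists_tw _ _
    choose a ha using h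
    have hs : ∀ {X Y : A} (_ : X ≅ Y), a X = a Y := by
      intro X Y e
      have h := α.hom.naturality e.hom
      rw [← ha, ← ha] at h
      change (toFun F).map e.hom ≫ _ = _ ≫ (toFun F).map e.hom at h
      simpa using h.symm
    have ht : ∀ X, a (Quotient.out (Pi0.mk X)) = a X := fun X =>
      hs (Pi0.iso_of_eq (Quotient.out_eq _)).some
    refine ⟨fun s => a s.out, ?_, ?_⟩
    · change a (Quotient.out (Pi0.mk (𝟙_ A))) = 0
      rw [ht]
      change ε (toFun F) ≫ _ = ε (toFun F) at h₁
      rw [← ha, comp_tw, Category.comp_id] at h₁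
      exact tw_left_injective (ε (toFun F)) (by rw [h₁, tw_zero])
    · funext s t
      induction s using Quotient.inductionOn with | _ X
      induction t using Quotient.inductionOn with | _ Y
      change a (Quotient.out (Pi0.mk Y)) - a (Quotient.out (Pi0.mk (X ⊗ Y))) +
        a (Quotient.out (Pi0.mk X)) = g.1 (Pi0.mk X) (Pi0.mk Y) - g'.1 (Pi0.mk X) (Pi0.mk Y)
      rw [ht, ht, ht]
      have h : tw (g.1 (Pi0.mk X) (Pi0.mk Y)) (μ (toFun F) X Y) ≫ α.hom.app (X ⊗ Y) =
        (α.hom.app X ⊗ₘ α.hom.app Y) ≫ tw (g'.1 (Pi0.mk X) (Pi0.mk Y)) (μ (toFun F) X Y) := h₂ X Y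
      rw [← ha, ← ha, ← ha] at h
      simp only [comp_tw, tw_comp, tw_tw, tw_tensorHom, tensorHom_tw, Category.comp_id,
        id_tensorHom_id, Category.id_comp] at h
      have h := sub_eq_zero.2 (tw_left_injective (μ (toFun F) X Y) h)
      rw [← sub_eq_zero, ← neg_eq_zero, ← h]; abel
  · rintro ⟨t, ht, h⟩
    refine ⟨NatIso.ofComponents (fun X => asIso (tw (t (Pi0.mk X)) (𝟙 ((toFun F).obj X))))
      fun {X Y} f => ?_, ?_, fun X Y => ?_⟩
    · change (toFun F).map f ≫ tw (t (Pi0.mk Y)) (𝟙 _) =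
        tw (t (Pi0.mk X)) (𝟙 _) ≫ (toFun F).map f
      rw [Pi0.sound (asIso f)]; simp
    · change ε (toFun F) ≫ tw (t 0) (𝟙 _) = ε (toFun F)
      rw [show t 0 = 0 from ht]; simp
    · change tw _ _ ≫ tw (t (Pi0.mk X + Pi0.mk Y)) (𝟙 _) = (tw (t (Pi0.mk X)) (𝟙 _) ⊗ₘ
        tw (t (Pi0.mk Y)) (𝟙 _)) ≫ tw (g'.1 (Pi0.mk X) (Pi0.mk Y)) (μ (toFun F) X Y)
      have h : t (Pi0.mk Y) - t (Pi0.mk X + Pi0.mk Y) + t (Pi0.mk X) =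
        g.1 (Pi0.mk X) (Pi0.mk Y) - g'.1 (Pi0.mk X) (Pi0.mk Y) :=
        congrFun (congrFun h (Pi0.mk X)) (Pi0.mk Y)
      simp only [comp_tw, tw_comp, tw_tw, tw_tensorHom, tensorHom_tw, Category.comp_id,
        id_tensorHom_id, Category.id_comp]
      congr 1
      have h := sub_eq_zero.2 h
      rw [← sub_eq_zero, ← neg_eq_zero, ← h]; abel

/-- Equality on `π₀` gives isomorphisms on chosen representatives. They are natural because an
automorphism of a representative is a twist of the identity and `F₁ = G₁`; they extend to all
objects along chosen isomorphisms. -/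
theorem exists_iso_of_map_eq {F G : A ⟶ B} (h₀ : map0 F = map0 G) (h₁ : map1 F = map1 G) :
    ∃ α : toFun F ≅ toFun G, ε (toFun F) ≫ α.hom.app (𝟙_ A) = ε (toFun G) := by
  have hr : ∀ s : Pi0 A, Nonempty ((toFun F).obj s.out ≅ (toFun G).obj s.out) := fun s =>
    Pi0.iso_of_eq (DFunLike.congr_fun h₀ (Pi0.mk s.out))
  let θ := fun s => (hr s).some
  have hθ : ∀ {s t : Pi0 A} (_ : s = t) (w : s.out ⟶ t.out),
      (toFun F).map w ≫ (θ t).hom = (θ s).hom ≫ (toFun G).map w := by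
    rintro s _ rfl w
    obtain ⟨a, rfl⟩ := exists_tw (𝟙 _) w
    simp [h₁]
  let e := fun X : A => (Pi0.iso_of_eq (Quotient.out_eq (Pi0.mk X)).symm).some
  let α : toFun F ≅ toFun G := NatIso.ofComponents
    (fun X => (toFun F).mapIso (e X) ≪≫ θ (Pi0.mk X) ≪≫ (toFun G).mapIso (e X).symm)
    fun {X Y} f => by
      have h := hθ (Pi0.sound (asIso f)) ((e X).inv ≫ f ≫ (e Y).hom)
      rw [← cancel_epi ((toFun F).map (e X).inv), ← cancel_mono ((toFun G).map (e Y).hom)]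
      simp only [Functor.map_comp, Category.assoc] at h
      simpa [← Functor.map_comp, ← Functor.map_comp_assoc] using h
  -- A global twist keeps naturality and corrects the value at the unit.
  obtain ⟨a, ha⟩ := exists_tw (ε (toFun F) ≫ α.hom.app (𝟙_ A)) (ε (toFun G))
  refine ⟨NatIso.ofComponents (fun X => asIso (tw a (α.hom.app X))) fun f => ?_, ?_⟩
  · simp
  · simpa using ha

/-- The cochain `a` measures how far `α` is from being monoidal; by naturality it descends to `π₀`.
Comparing unitality, braiding and associativity of `F` and `G` gives normalization, symmetry and the
cocycle identity. -/
theorem exists_homotopic_twist {F G : A ⟶ B} (h₀ : map0 F = map0 G) (h₁ : map1 F = map1 G) :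
    ∃ g, Homotopic (twist F g) G := by
  obtain ⟨α, hα⟩ := exists_iso_of_map_eq h₀ h₁
  have h : ∀ X Y, ∃ a : Pi1 B, tw a (μ (toFun F) X Y ≫ α.hom.app (X ⊗ Y)) =
    (α.hom.app X ⊗ₘ α.hom.app Y) ≫ μ (toFun G) X Y := fun X Y => exists_tw _ _
  choose a ha using h
  have hs : ∀ {X X' Y Y' : A} (_ : X ≅ X') (_ : Y ≅ Y'), a X Y = a X' Y' := by
    intro X X' Y Y' e e'
    apply tw_left_injective (μ (toFun F) X Y ≫ α.hom.app _ ≫ (toFun G).map (e.hom ⊗ₘ e'.hom))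
    have h : ((toFun F).map e.hom ⊗ₘ (toFun F).map e'.hom) ≫
      (α.hom.app X' ⊗ₘ α.hom.app Y') ≫ μ (toFun G) X' Y' =
      (α.hom.app X ⊗ₘ α.hom.app Y) ≫ μ (toFun G) X Y ≫ (toFun G).map (e.hom ⊗ₘ e'.hom) := by
      rw [← μ_natural, tensorHom_comp_tensorHom_assoc, tensorHom_comp_tensorHom_assoc,
        α.hom.naturality, α.hom.naturality]
    rw [← ha, comp_tw, μ_natural_assoc, α.hom.naturality, ← reassoc_of% ha X Y] at h
    simpa using h.symm
  let g : Pi0 A → Pi0 A → Pi1 B := fun s t => a s.out t.out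
  have hg : ∀ X Y, g (Pi0.mk X) (Pi0.mk Y) = a X Y := fun X Y =>
    hs (Pi0.iso_of_eq (Quotient.out_eq _)).some (Pi0.iso_of_eq (Quotient.out_eq _)).some
  clear_value g
  refine ⟨⟨g, mem_Z2ab ?_ ?_ ?_ ?_⟩, (homotopic_twist_iff_exists _ _ _).2
    ⟨α, hα, fun X Y =>
      (congrArg (tw · _ ≫ _) (hg X Y)).trans ((tw_comp _ _ _).trans (ha X Y))⟩⟩
  · intro s
    induction s using Quotient.inductionOn with | _ X
    refine (hg X (𝟙_ A)).trans ?_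
    have h := congrArg ((toFun F).obj X ◁ ε (toFun F) ≫ ·) (ha X (𝟙_ A))
    apply tw_left_injective ((ρ_ ((toFun F).obj X)).hom ≫ (toFun F).map (ρ_ X).inv ≫ α.hom.app _)
    simp only [← id_tensorHom, comp_tw, tensorHom_comp_tensorHom_assoc, Category.id_comp, hα,
      tensorHom_ε_comp_μ, tensorHom_ε_comp_μ_assoc, id_whiskerRight] at h
    rw [h, tw_zero, α.hom.naturality, rightUnitor_naturality_assoc]
  · intro s
    induction s using Quotient.inductionOn with | _ X
    refine (hg (𝟙_ A) X).trans ?_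
    have h := congrArg (ε (toFun F) ▷ (toFun F).obj X ≫ ·) (ha (𝟙_ A) X)
    apply tw_left_injective ((λ_ ((toFun F).obj X)).hom ≫ (toFun F).map (λ_ X).inv ≫ α.hom.app _)
    simp only [← tensorHom_id, comp_tw, tensorHom_comp_tensorHom_assoc, Category.id_comp, hα,
      ε_tensorHom_comp_μ, ε_tensorHom_comp_μ_assoc, whiskerLeft_id] at h
    rw [h, tw_zero, α.hom.naturality, leftUnitor_naturality_assoc]
  · intro s t
    induction s using Quotient.inductionOn with | _ X
    induction t using Quotient.inductionOn with | _ Y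
    refine (hg Y X).trans (.trans ?_ (hg X Y).symm)
    apply tw_left_injective (μ (toFun F) X Y ≫ α.hom.app _ ≫ (toFun G).map (β_ X Y).hom)
    have h : (α.hom.app X ⊗ₘ α.hom.app Y) ≫ μ (toFun G) X Y ≫ (toFun G).map (β_ X Y).hom =
        (β_ _ _).hom ≫ (α.hom.app Y ⊗ₘ α.hom.app X) ≫ μ (toFun G) Y X := by
      rw [Functor.LaxBraided.braided, BraidedCategory.braiding_naturality_assoc]
    rw [← reassoc_of% ha X Y, ← ha, comp_tw, ← Functor.LaxBraided.braided_assoc,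
      α.hom.naturality] at h
    simpa using h.symm
  · intro s t r
    induction s using Quotient.inductionOn with | _ X
    induction t using Quotient.inductionOn with | _ Y
    induction r using Quotient.inductionOn with | _ Z
    have e₁ := hg Y Z
    have e₂ := hg X (Y ⊗ Z)
    have e₃ := hg X Y
    have e₄ := hg (X ⊗ Y) Z
    refine (congrArg₂ _ e₁ e₂).trans (.trans ?_ (congrArg₂ _ e₃ e₄).symm)
    -- The same composite is evaluated twice: directly, and after applying associativity of `G` and
    -- then of `F`.
    have left : ((α.hom.app X ⊗ₘ α.hom.app Y) ⊗ₘ α.hom.app Z) ≫ μ (toFun G) X Y ▷ _ ≫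
        μ (toFun G) (X ⊗ Y) Z ≫ (toFun G).map (α_ X Y Z).hom = tw (a X Y + a (X ⊗ Y) Z)
        (μ (toFun F) X Y ▷ _ ≫ μ (toFun F) (X ⊗ Y) Z ≫ (toFun F).map (α_ X Y Z).hom ≫
          α.hom.app _) := by
      rw [α.hom.naturality, ← tensorHom_id, tensorHom_comp_tensorHom_assoc, ← ha, Category.comp_id,
        ← Category.id_comp (α.hom.app Z), tw_tensorHom, ← tensorHom_comp_tensorHom, tw_comp,
        Category.assoc, ← reassoc_of% ha (X ⊗ Y) Z]
      simp
    have right : ((α.hom.app X ⊗ₘ α.hom.app Y) ⊗ₘ α.hom.app Z) ≫ μ (toFun G) X Y ▷ _ ≫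
        μ (toFun G) (X ⊗ Y) Z ≫ (toFun G).map (α_ X Y Z).hom = tw (a Y Z + a X (Y ⊗ Z))
        (μ (toFun F) X Y ▷ _ ≫ μ (toFun F) (X ⊗ Y) Z ≫ (toFun F).map (α_ X Y Z).hom ≫
          α.hom.app _) := by
      rw [Functor.LaxMonoidal.associativity, Functor.LaxMonoidal.associativity_assoc,
        associator_naturality_assoc, ← id_tensorHom, tensorHom_comp_tensorHom_assoc, ← ha,
        Category.comp_id, ← Category.id_comp (α.hom.app X), tensorHom_tw,
        ← tensorHom_comp_tensorHom, tw_comp, Category.assoc, ← ha X (Y ⊗ Z)]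
      simp
    exact tw_left_injective _ (right.symm.trans left)

/-- The set of homotopy classes of braided Gr-functors which induce the same pair as `F` is
a torsor under `H²_ab`, which acts by twisting the tensor constraint. -/
noncomputable def homClassesEquiv {φ : Pi0 A →+ Pi0 B} {f : Pi1 A →+ Pi1 B} (F : A ⟶ B)
    (h₀ : map0 F = φ) (h₁ : map1 F = f) : H2ab (Pi0 A) (Pi1 B) ≃ HomClasses φ f :=
  have key (g g' : Z2ab (Pi0 A) (Pi1 B)) :
      Homotopic (twist F g) (twist F g') ↔ (g : H2ab (Pi0 A) (Pi1 B)) = g' := by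
    rw [eq_comm, QuotientAddGroup.eq, homotopic_twist_twist_iff, neg_add_eq_sub]
    rfl
  Equiv.ofBijective
    (fun x => Quotient.liftOn x
      (fun g => Quotient.mk (homotopySetoid φ f)
        ⟨twist F g, (map0_twist F g).trans h₀, (map1_twist F g).trans h₁⟩)
      fun g g' h => Quotient.sound ((key g g').2 (Quotient.sound h)))
    ⟨fun x y => by
      induction x using QuotientAddGroup.induction_on with | _ g
      induction y using QuotientAddGroup.induction_on with | _ g'
      exact fun h => (key g g').1 (Quotient.exact h),
    fun y => by
      induction y using Quotient.inductionOn with | _ G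
      obtain ⟨g, hg⟩ := exists_homotopic_twist (h₀.trans G.2.1.symm) (h₁.trans G.2.2.symm)
      exact ⟨(g : H2ab (Pi0 A) (Pi1 B)), Quotient.sound hg⟩⟩

end Twist

/-! ### Failure of faithfulness -/

section NotFaithful

/-- For `M = N = ℤ/2` the cocycle `g` is the carry cocycle of the extension `ℤ/4`. A coboundary
takes the value `2 t(m) = 0` at `(m, m)`, whereas `g` takes the value `n`. -/
theorem nontrivial_H2ab {M : Type u} {N : Type v} [AddCommGroup M] [AddCommGroup N] {m : M} {n : N}
    (hm : m ≠ 0) (hM : ∀ x, x = 0 ∨ x = m) (hn : n ≠ 0) (hN : ∀ x : N, x + x = 0) :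
    Nontrivial (H2ab M N) := by
  classical
  have hm₂ : m + m = 0 := (hM (m + m)).resolve_right fun h => hm (add_eq_left.1 h)
  let g : M → M → N := fun x y => if x = m ∧ y = m then n else 0
  have hg : g ∈ Z2ab M N := by
    refine mem_Z2ab (fun x => ?_) (fun y => ?_) (fun x y => ?_) fun x y z => ?_
    · simp [g, hm.symm]
    · simp [g, hm.symm]
    · simp only [g, and_comm]
    · rcases hM x with rfl | rfl <;> rcases hM y with rfl | rfl <;> rcases hM z with rfl | rfl <;>
        simp [g, hm.symm, hm₂]
  refine ⟨(⟨g, hg⟩ : Z2ab M N), 0, fun h => ?_⟩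
  obtain ⟨t, ht, h⟩ := (QuotientAddGroup.eq_zero_iff _).1 h
  have h : t m - t (m + m) + t m = g m m := congrFun (congrFun h m) m
  rw [hm₂, show t 0 = 0 from ht, sub_zero, hN] at h
  simp [g] at h
  exact hn h.symm

/-- A faithful `d` would leave only one functor inducing the identity pair of `R`, but there is more
than one homotopy class of them. -/
theorem not_classify_faithful : ¬ (classify.{v, u}).Faithful := by
  intro _
  let R := reduced (0 : Z3ab (ULift.{u} (ZMod 2)) (ULift.{v} (ZMod 2)))
  have hz : ∀ x : ZMod 2, x = 0 ∨ x = 1 := by decide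
  have hz₂ : ∀ x : ZMod 2, x + x = 0 := by decide
  let e : Pi0 R ≃+ ZMod 2 := (reducedPi0 _).trans AddEquiv.ulift
  let e' : Pi1 R ≃+ ZMod 2 := (reducedPi1 _).trans AddEquiv.ulift
  have : Nontrivial (H2ab (Pi0 R) (Pi1 R)) := by
    refine nontrivial_H2ab (m := e.symm 1) (n := e'.symm 1) (by simp) (fun x => ?_) (by simp)
      fun x => e'.injective ?_
    · rw [← e.injective.eq_iff, ← e.injective.eq_iff, map_zero, e.apply_symm_apply]
      exact hz _
    · rw [map_add, map_zero, hz₂]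
  have : Nontrivial (HomClasses (map0 (𝟙 R)) (map1 (𝟙 R))) :=
    (homClassesEquiv (𝟙 R) rfl rfl).symm.nontrivial
  obtain ⟨x, y, hxy⟩ := exists_pair_ne (HomClasses (map0 (𝟙 R)) (map1 (𝟙 R)))
  induction x using Quotient.inductionOn with | _ F
  induction y using Quotient.inductionOn with | _ G
  apply hxy
  congr 1
  exact Subtype.ext (classify.map_injective (classify_map_eq_iff.2
    ⟨F.2.1.trans G.2.1.symm, F.2.2.trans G.2.2.symm⟩))

end NotFaithful

end BrGr

open BrGr
theorem theorem4p3 :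
    ∃ (c : ∀ B : BCG.{v, u}, H3ab (Pi0 B) (Pi1 B))
      (hc : ∀ (A B : BCG.{v, u}) (F : A ⟶ B),
        H3pull (Pi1 B) (map0 F) (c B) = H3push (Pi0 A) (map1 F) (c A)),
      (∀ B : BCG.{v, u}, IsClassOf B (c B)) ∧
      (∀ (A B : BCG.{v, u}) (F : A ⟶ B),
        (IsIso ((classifyingFunctor c hc).map F) ↔ IsBraidedEquivalence F) ∧
        (IsIso ((classifyingFunctor c hc).map F) ↔ (toFun F).IsEquivalence)) ∧
      (classifyingFunctor c hc).EssSurj ∧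
      (classifyingFunctor c hc).Full ∧
      ¬ (classifyingFunctor c hc).Faithful ∧
      (∀ (A B : BCG.{v, u})
        (p : (classifyingFunctor c hc).obj A ⟶ (classifyingFunctor c hc).obj B),
        Nonempty (HomClasses p.φ p.f ≃ H2ab (Pi0 A) (Pi1 B))) := by
  refine ⟨cls, pull_cls_eq_push_cls, isClassOf_cls,
    fun A B F => ⟨isIso_classify_map_iff_isBraidedEquivalence F,
      isIso_classify_map_iff_isEquivalence F⟩,
    classify_essSurj, classify_full, not_classify_faithful, fun A B p => ?_⟩
  -- Fullness supplies the base point of the torsor.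
  obtain ⟨F, rfl⟩ := classify_full.map_surjective p
  exact ⟨(homClassesEquiv F rfl rfl).symm⟩
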